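/- Let $R$ be a commutative artinian ring and let $\mathcal C$ be a dualizing $R$-variety: $\mathcal C$ is a small additive $R$-linear category in which idempotents split, every $\mathcal C(X,Y)$ is a finitely generated $R$-module, and $M\mapsto \mathrm{Hom}_R(M(-),E)$, where $E$ is the injective envelope of $R/\mathrm{rad}(R)$, restricts to a duality from $\mathrm{mod}(\mathcal C)$ to $\mathrm{mod}(\mathcal C^{op})$. Here, for a small preadditive category $\mathcal D$, $\mathrm{Mod}(\mathcal D)$ is the category of additive covariant functors $\mathcal D\to\mathbf{Ab}$ and $\mathrm{mod}(\mathcal D)$ is its full subcategory of finitely presented functors, i.e. of those $M$ with an exact sequence $\mathcal D(X_0,-)\to\mathcal D(X_1,-)\to M\to 0$; for $\mathcal D=\mathcal C,\mathcal C^{op}$ the group $M(X)$ is an $R$-module, $r\in R$ acting as $M(r\cdot 1_X)$. Let $C\in\mathcal C$, $P=\mathcal C(C,-)$, $\mathcal B=\mathrm{add}(C)$ (the objects $X$ with $X\oplus Y\cong C^n$ for some $Y\in\mathcal C$ and $n\in\mathbb N$), let $\mathcal I=\mathcal I_{\mathcal B}$ be the ideal of the morphisms of $\mathcal C$ that factor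 through an object of $\mathcal B$, let $\pi:\mathcal C\to\mathcal C/\mathcal I$ be the quotient functor, $R_P=\mathrm{End}_{\mathrm{Mod}(\mathcal C)}(P)^{op}$, and let $\mathrm{mod}(R_P)$ be the category of finitely generated left $R_P$-modules. Consider the functors $$\pi_*:\mathrm{Mod}(\mathcal C/\mathcal I)\to\mathrm{Mod}(\mathcal C),\quad \pi_*(F)=F\circ\pi;$$ $$\tfrac{\mathcal C}{\mathcal I}\otimes_{\mathcal C}-:\mathrm{Mod}(\mathcal C)\to\mathrm{Mod}(\mathcal C/\mathcal I),\quad \big(\tfrac{\mathcal C}{\mathcal I}\otimes_{\mathcal C}M\big)(X)=\tfrac{\mathcal C(-,X)}{\mathcal I(-,X)}\otimes_{\mathcal C}M;$$ $$\mathcal C(\tfrac{\mathcal C}{\mathcal I},-):\mathrm{Mod}(\mathcal C)\to\mathrm{Mod}(\mathcal C/\mathcal I),\quad \mathcal C(\tfrac{\mathcal C}{\mathcal I},M)(X)=\mathrm{Hom}_{\mathrm{Mod}(\mathcal C)}\big(\tfrac{\mathcal C(X,-)}{\mathcal I(X,-)},M\big);$$ $$\mathrm{Hom}(P,-)=\mathrm{Hom}_{\mathrm{Mod}(\mathcal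 C)}(P,-):\mathrm{Mod}(\mathcal C)\to\mathrm{Mod}(R_P);$$ $$P\otimes_{R_P}-:\mathrm{Mod}(R_P)\to\mathrm{Mod}(\mathcal C),\quad (P\otimes_{R_P}N)(X)=P(X)\otimes_{R_P}N;$$ $$\mathrm{Hom}_{R_P}(P^*,-):\mathrm{Mod}(R_P)\to\mathrm{Mod}(\mathcal C),\quad \mathrm{Hom}_{R_P}(P^*,N)(X)=\mathrm{Hom}_{R_P}(P^*(X),N),$$ where $P^*(X)=\mathrm{Hom}_{\mathrm{Mod}(\mathcal C)}(P,\mathcal C(X,-))$. Then these six functors restrict to functors between $\mathrm{mod}(\mathcal C/\mathcal I)$, $\mathrm{mod}(\mathcal C)$ and $\mathrm{mod}(R_P)$, and the restrictions form a recollement $$\mathrm{mod}(\mathcal C/\mathcal I)\xrightarrow{\ \pi_*\ }\mathrm{mod}(\mathcal C)\xrightarrow{\ \mathrm{Hom}(P,-)\ }\mathrm{mod}(R_P).$$ That is, the three categories are abelian; the six restricted functors are additive; on these categories $\tfrac{\mathcal C}{\mathcal I}\otimes_{\mathcal C}-$ is left adjoint and $\mathcal C(\tfrac{\mathcal C}{\mathcal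 I},-)$ is right adjoint to $\pi_*$, while $P\otimes_{R_P}-$ is left adjoint and $\mathrm{Hom}_{R_P}(P^*,-)$ is right adjoint to $\mathrm{Hom}(P,-)$; $\mathrm{Hom}(P,\pi_*(F))=0$ for all $F\in\mathrm{mod}(\mathcal C/\mathcal I)$; and the restrictions of $\pi_*$, $P\otimes_{R_P}-$ and $\mathrm{Hom}_{R_P}(P^*,-)$ are fully faithful. Moreover $\mathcal I_{\mathcal B}=\mathrm{Tr}_P\mathcal C$, where $(\mathrm{Tr}_P\mathcal C)(X,Y)=\sum_{f}\mathrm{Im}(f_Y)\subseteq\mathcal C(X,Y)$, the sum being over all morphisms $f:P\to\mathcal C(X,-)$ in $\mathrm{Mod}(\mathcal C)$. -/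

import Mathlib

open CategoryTheory CategoryTheory.Limits Opposite
open scoped TensorProduct DirectSum

universe u v₁ v₂ v₃ u₁ u₂ u₃

noncomputable section

namespace DualizingVariety

/-! ### Modules over a small preadditive category -/

section Modules

variable (C : Type u) [Category.{u} C] [Preadditive C]

/-- The category `Mod(C)` of additive covariant functors from `C` to abelian groups. -/
abbrev ModC : Type (u + 1) := C ⥤+ AddCommGrpCat.{u}

/-- The contravariant Yoneda functor `X ↦ Hom_C(X, -)` with values in `Mod(C)`. -/
def repFunctor : Cᵒᵖ ⥤ ModC C :=
  (additiveFunctor C AddCommGrpCat.{u}).lift preadditiveCoyoneda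
    (fun X => additive_coyonedaObj' X)

variable {C}

/-- The `C`-module `Hom_C(X, -)`. -/
abbrev rep (X : C) : ModC C := (repFunctor C).obj (op X)

instance repFunctor_additive : (repFunctor C).Additive where
  map_add {X Y f g} := by
    apply ObjectProperty.hom_ext
    ext Z h
    exact Preadditive.add_comp _ _ _ f.unop g.unop h

variable (C)

/-- The finitely presented `C`-modules: those `M` with an exact sequence
`Hom_C(X₀, -) ⟶ Hom_C(X₁, -) ⟶ M ⟶ 0` in `Mod(C)` (exactness is checked objectwise). -/
def IsFP : ObjectProperty (ModC C) := fun M =>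
  ∃ (X₀ X₁ : C) (f : rep X₀ ⟶ rep X₁) (g : rep X₁ ⟶ M), ∀ Y : C,
    Function.Exact (f.hom.app Y) (g.hom.app Y) ∧ Function.Surjective (g.hom.app Y)

/-- The category `mod(C)` of finitely presented `C`-modules. -/
abbrev FPMod : Type (u + 1) := (IsFP C).FullSubcategory

end Modules

/-! ### Dualizing varieties -/

section Dualizing

variable (R : Type u) [CommRing R]

/-- `ι : N ⟶ E` is an injective envelope of the `R`-module `N`: `E` is injective and `ι` is an
essential monomorphism. -/
structure IsInjectiveEnvelope {N E : ModuleCat.{u} R} (ι : N ⟶ E) : Prop where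
  injective : Module.Injective R E
  mono : Function.Injective ι
  essential : ∀ S : Submodule R E, S ≠ ⊥ → S ⊓ LinearMap.range ι.hom ≠ ⊥

variable {C : Type u} [Category.{u} C] [Preadditive C] [Linear R C]

/-- The `R`-module structure on `M(X)`: the scalar `r` acts through the endomorphism `r • 𝟙 X`. -/
@[reducible]
def evalModule (M : ModC C) (X : C) : Module R (M.obj.obj X) where
  smul r x := M.obj.map (r • 𝟙 X) x
  one_smul x := by
    change M.obj.map ((1 : R) • 𝟙 X) x = x
    simp
  mul_smul r s x := by
    change M.obj.map ((r * s) • 𝟙 X) x = M.obj.map (r • 𝟙 X) (M.obj.map (s • 𝟙 X) x)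
    rw [← ConcreteCategory.comp_apply, ← M.obj.map_comp]
    simp [smul_smul]
  smul_zero r := map_zero (M.obj.map (r • 𝟙 X)).hom
  smul_add r x y := map_add (M.obj.map (r • 𝟙 X)).hom x y
  add_smul r s x := by
    change M.obj.map ((r + s) • 𝟙 X) x = M.obj.map (r • 𝟙 X) x + M.obj.map (s • 𝟙 X) x
    rw [add_smul, Functor.map_add]
    rfl
  zero_smul x := by
    change M.obj.map ((0 : R) • 𝟙 X) x = 0
    rw [zero_smul, Functor.map_zero]
    rfl

/-- A `C`-module `M : C ⥤ Ab` viewed as a functor with values in `R`-modules. -/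
def toModuleR (M : ModC C) : C ⥤ ModuleCat.{u} R where
  obj X := letI := evalModule R M X; ModuleCat.of R (M.obj.obj X)
  map {X Y} f :=
    letI := evalModule R M X
    letI := evalModule R M Y
    ModuleCat.ofHom
      { toFun := M.obj.map f
        map_add' := map_add (M.obj.map f).hom
        map_smul' := fun r x => by
          change M.obj.map f (M.obj.map (r • 𝟙 X) x) = M.obj.map (r • 𝟙 Y) (M.obj.map f x)
          rw [← ConcreteCategory.comp_apply, ← ConcreteCategory.comp_apply,
            ← M.obj.map_comp, ← M.obj.map_comp]
          simp }
  map_id X := by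
    let := evalModule R M X
    exact ModuleCat.hom_ext (LinearMap.ext fun x =>
      congrArg (fun k : M.obj.obj X ⟶ M.obj.obj X => k x) (M.obj.map_id X))
  map_comp {X _ Z} f g := by
    let := evalModule R M X
    let := evalModule R M Z
    exact ModuleCat.hom_ext (LinearMap.ext fun x =>
      congrArg (fun k : M.obj.obj X ⟶ M.obj.obj Z => k x) (M.obj.map_comp f g))

instance toModuleR_additive (M : ModC C) : (toModuleR R M).Additive where
  map_add {X Y f g} := by
    ext x
    change M.obj.map (f + g) x = M.obj.map f x + M.obj.map g x
    rw [Functor.map_add]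
    rfl

/-- A morphism of `C`-modules is `R`-linear at each object. -/
def toModuleRMap {M N : ModC C} (α : M ⟶ N) : toModuleR R M ⟶ toModuleR R N where
  app X :=
    letI := evalModule R M X
    letI := evalModule R N X
    ModuleCat.ofHom
      { toFun := α.hom.app X
        map_add' := map_add (α.hom.app X).hom
        map_smul' := fun r x => by
          change α.hom.app X (M.obj.map (r • 𝟙 X) x) = N.obj.map (r • 𝟙 X) (α.hom.app X x)
          rw [← ConcreteCategory.comp_apply, ← ConcreteCategory.comp_apply, α.hom.naturality] }
  naturality X Y f := ModuleCat.hom_ext <| LinearMap.ext fun x =>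
    congrArg (fun k : M.obj.obj X ⟶ N.obj.obj Y => k x) (α.hom.naturality f)

variable (C)

/-- The functor `M ↦ Hom_R(M(-), E)` from `C`-modules to `Cᵒᵖ`-modules. -/
def dual (E : ModuleCat.{u} R) : (ModC C)ᵒᵖ ⥤ ModC Cᵒᵖ where
  obj M := AdditiveFunctor.of ((toModuleR R M.unop).op ⋙ preadditiveYoneda.obj E)
  map α := ObjectProperty.homMk
    (Functor.whiskerRight (NatTrans.op (toModuleRMap R α.unop)) (preadditiveYoneda.obj E))
  map_id M := by
    apply ObjectProperty.hom_ext
    ext X h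
    rfl
  map_comp α β := by
    apply ObjectProperty.hom_ext
    ext X h
    rfl

/-- Let `R` be a commutative artinian ring and `C` an `R`-variety, that is, a small additive
`R`-linear category in which idempotents split. `C` is a dualizing `R`-variety if it is
`Hom`-finite and `M ↦ Hom_R(M(-), E)`, with `E` the injective envelope of `R / rad R`, restricts
to a duality from `mod(C)` to `mod(Cᵒᵖ)`. -/
structure IsDualizing [IsArtinianRing R] [HasFiniteBiproducts C] [IsIdempotentComplete C] :
    Prop where
  homFinite : ∀ X Y : C, Module.Finite R (X ⟶ Y)
  duality : ∃ (E : ModuleCat.{u} R) (ι : ModuleCat.of R (R ⧸ Ring.jacobson R) ⟶ E),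
    IsInjectiveEnvelope R ι ∧
    ∃ h : ∀ M : (FPMod C)ᵒᵖ, IsFP Cᵒᵖ ((dual R C E).obj (op M.unop.obj)),
      ((IsFP Cᵒᵖ).lift ((IsFP C).ι.op ⋙ dual R C E) h).IsEquivalence

end Dualizing

/-! ### Ideals and quotient categories -/

section Ideals

variable (C : Type u) [Category.{u} C] [Preadditive C]

/-- A two-sided ideal of a preadditive category. -/
@[ext]
structure CatIdeal where
  carrier : ∀ X Y : C, AddSubgroup (X ⟶ Y)
  comp_mem : ∀ {W X Y Z : C} (g : W ⟶ X) (f : X ⟶ Y) (h : Y ⟶ Z),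
    f ∈ carrier X Y → g ≫ f ≫ h ∈ carrier W Z

variable {C}

namespace CatIdeal

variable (I : CatIdeal C)

/-- Congruence modulo the ideal. -/
def homRel : HomRel C := fun {X Y} f g => f - g ∈ I.carrier X Y

instance congruence : Congruence I.homRel where
  equivalence {X Y} :=
    { refl := fun f => by simp [homRel, zero_mem]
      symm := fun {f g} h => by
        have := neg_mem h
        rwa [neg_sub] at this
      trans := fun {f g k} h h' => by
        have := add_mem h h'
        rwa [sub_add_sub_cancel] at this }
  comp_left {X Y Z} f {g g'} h := by
    have := I.comp_mem f (g - g') (𝟙 _) h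
    simpa [homRel] using this
  comp_right {X Y Z f f'} g h := by
    have := I.comp_mem (𝟙 _) (f - f') g h
    simpa [homRel] using this

/-- The quotient category `C / I`: same objects, and
`Hom_{C/I}(X, Y) = Hom_C(X, Y) / I(X, Y)`. -/
abbrev Quot : Type u := CategoryTheory.Quotient I.homRel

theorem homRel_add ⦃X Y : C⦄ (f₁ f₂ g₁ g₂ : X ⟶ Y) (h : I.homRel f₁ f₂) (h' : I.homRel g₁ g₂) :
    I.homRel (f₁ + g₁) (f₂ + g₂) := by
  have := add_mem h h'
  rwa [sub_add_sub_comm] at this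

instance quotPreadditive : Preadditive I.Quot :=
  CategoryTheory.Quotient.preadditive I.homRel I.homRel_add

/-- The canonical functor `π : C ⥤ C / I`. -/
abbrev proj : C ⥤ I.Quot := CategoryTheory.Quotient.functor I.homRel

instance proj_additive : I.proj.Additive :=
  CategoryTheory.Quotient.functor_additive I.homRel I.homRel_add

/-- The functor `π_* : Mod(C/I) ⥤ Mod(C)`, `F ↦ F ∘ π`. -/
def piStar : ModC I.Quot ⥤ ModC C where
  obj F := AdditiveFunctor.of (I.proj ⋙ F.obj)
  map α := ObjectProperty.homMk (Functor.whiskerLeft I.proj α.hom)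

instance piStar_additive : I.piStar.Additive where

end CatIdeal

end Ideals

/-! ### `add(c)`, the ideal of maps factoring through it, and the trace ideal -/

section AddTrace

variable {C : Type u} [Category.{u} C] [Preadditive C]

section AddIdeal

variable [HasFiniteBiproducts C]

attribute [local instance] hasBinaryBiproducts_of_finite_biproducts

/-- `add(c)`: the objects `X` such that `X ⊕ Y ≅ cⁿ` for some object `Y` and some `n`. -/
def addOf (c : C) : ObjectProperty C := fun X =>
  ∃ (Y : C) (n : ℕ), Nonempty (X ⊞ Y ≅ ⨁ fun _ : Fin n => c)

/-- The middle exchange isomorphism for biproducts. -/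
def biprodExchange (X X' Y Y' : C) : (X ⊞ X') ⊞ (Y ⊞ Y') ≅ (X ⊞ Y) ⊞ (X' ⊞ Y') where
  hom := biprod.desc (biprod.map biprod.inl biprod.inl) (biprod.map biprod.inr biprod.inr)
  inv := biprod.desc (biprod.map biprod.inl biprod.inl) (biprod.map biprod.inr biprod.inr)
  hom_inv_id := by ext <;> simp
  inv_hom_id := by ext <;> simp

/-- `cⁿ ⊕ cᵐ ≅ cⁿ⁺ᵐ`. -/
def powAddIso (c : C) (n m : ℕ) :
    (⨁ fun _ : Fin n => c) ⊞ (⨁ fun _ : Fin m => c) ≅ ⨁ fun _ : Fin (n + m) => c where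
  hom := biprod.desc
    (biproduct.desc fun i => biproduct.ι (fun _ : Fin (n + m) => c) (Fin.castAdd m i))
    (biproduct.desc fun i => biproduct.ι (fun _ : Fin (n + m) => c) (Fin.natAdd n i))
  inv := biproduct.desc (Fin.addCases
    (fun i => biproduct.ι (fun _ : Fin n => c) i ≫ biprod.inl)
    (fun i => biproduct.ι (fun _ : Fin m => c) i ≫ biprod.inr))
  hom_inv_id := by
    apply biprod.hom_ext' <;> apply biproduct.hom_ext' <;> intro i <;> simp
  inv_hom_id := by
    apply biproduct.hom_ext'
    intro i
    refine Fin.addCases (fun i => ?_) (fun i => ?_) i <;> simp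

theorem addOf_biprod {c X X' : C} (h : addOf c X) (h' : addOf c X') : addOf c (X ⊞ X') := by
  obtain ⟨Y, n, ⟨e⟩⟩ := h
  obtain ⟨Y', m, ⟨e'⟩⟩ := h'
  exact ⟨Y ⊞ Y', n + m,
    ⟨biprodExchange X X' Y Y' ≪≫ biprod.mapIso e e' ≪≫ powAddIso c n m⟩⟩

theorem addOf_pow_zero (c : C) : addOf c (⨁ fun _ : Fin 0 => c) := by
  refine ⟨⨁ fun _ : Fin 0 => c, 0, ⟨biprod.desc (𝟙 _) (𝟙 _), biprod.inl, ?_, ?_⟩⟩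
  · apply biprod.hom_ext' <;> apply biproduct.hom_ext' <;> intro i <;> exact i.elim0
  · simp

/-- The ideal `I_B`, `B = add(c)`, of the morphisms which factor through an object of `B`. -/
def factorIdeal (c : C) : CatIdeal C where
  carrier X Y :=
    { carrier := {f | ∃ (Z : C) (a : X ⟶ Z) (b : Z ⟶ Y), addOf c Z ∧ a ≫ b = f}
      zero_mem' := ⟨_, 0, 0, addOf_pow_zero c, by simp⟩
      add_mem' := by
        rintro _ _ ⟨Z, a, b, hZ, rfl⟩ ⟨Z', a', b', hZ', rfl⟩
        exact ⟨Z ⊞ Z', biprod.lift a a', biprod.desc b b', addOf_biprod hZ hZ', by simp⟩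
      neg_mem' := by
        rintro _ ⟨Z, a, b, hZ, rfl⟩
        exact ⟨Z, -a, b, hZ, by simp⟩ }
  comp_mem := by
    rintro W X Y Z g _ h ⟨T, a, b, hT, rfl⟩
    exact ⟨T, g ≫ a, b ≫ h, hT, by simp⟩

end AddIdeal

/-- The value at `Y` of the trace of `P` in `N`: the sum of the images `Im(f_Y)`, over all
morphisms `f : P ⟶ N`. -/
def trace (P N : ModC C) (Y : C) : AddSubgroup (N.obj.obj Y) :=
  ⨆ f : P ⟶ N, (f.hom.app Y).hom.range

theorem trace_map (P : ModC C) {N N' : ModC C} (α : N ⟶ N') (Y : C) :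
    (trace P N Y).map (α.hom.app Y).hom ≤ trace P N' Y := by
  rw [trace, AddSubgroup.map_iSup]
  refine iSup_le fun f => le_trans ?_ (le_iSup _ (f ≫ α))
  rintro _ ⟨_, ⟨p, rfl⟩, rfl⟩
  exact ⟨p, rfl⟩

theorem trace_obj_map (P N : ModC C) {Y Y' : C} (h : Y ⟶ Y') :
    (trace P N Y).map (N.obj.map h).hom ≤ trace P N Y' := by
  rw [trace, AddSubgroup.map_iSup]
  refine iSup_le fun f => le_trans ?_ (le_iSup _ f)
  rintro _ ⟨_, ⟨p, rfl⟩, rfl⟩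
  exact ⟨P.obj.map h p, congrArg (fun k : P.obj.obj Y ⟶ N.obj.obj Y' => k p) (f.hom.naturality h)⟩

/-- The trace ideal `Tr_P C`: `(Tr_P C)(X, Y) = Tr_P(Hom_C(X, -))(Y)`. -/
def traceIdeal (P : ModC C) : CatIdeal C where
  carrier X Y := (trace P (rep X) Y : AddSubgroup (X ⟶ Y))
  comp_mem {W X Y Z} g f h hf := by
    have h1 : f ≫ h ∈ trace P (rep X) Z :=
      trace_obj_map P (rep X) h (AddSubgroup.mem_map_of_mem ((rep X).obj.map h).hom hf)
    exact trace_map P ((repFunctor C).map g.op) Z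
      (AddSubgroup.mem_map_of_mem (((repFunctor C).map g.op).hom.app Z).hom h1)

end AddTrace

/-! ### Tensor products -/

section Tensor

variable {C : Type u} [Category.{u} C] [Preadditive C]

/-- The map `f ⊗ g` of tensor products of abelian groups. -/
def abTensorMap {A A' B B' : AddCommGrpCat.{u}} (f : A ⟶ A') (g : B ⟶ B') :
    A ⊗[ℤ] B →+ A' ⊗[ℤ] B' :=
  (TensorProduct.map f.hom.toIntLinearMap g.hom.toIntLinearMap).toAddMonoidHom

open Classical in
/-- The relations `a·f ⊗ m = a ⊗ f·m` of the tensor product over `C`. -/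
def tensorRel (A : ModC Cᵒᵖ) (M : ModC C) :
    AddSubgroup (⨁ X : C, A.obj.obj (op X) ⊗[ℤ] M.obj.obj X) :=
  AddSubgroup.closure {z | ∃ (X Y : C) (f : X ⟶ Y) (a : A.obj.obj (op Y)) (m : M.obj.obj X),
    z = DirectSum.of (fun X : C => A.obj.obj (op X) ⊗[ℤ] M.obj.obj X) X
          (A.obj.map f.op a ⊗ₜ[ℤ] m)
      - DirectSum.of (fun X : C => A.obj.obj (op X) ⊗[ℤ] M.obj.obj X) Y
          (a ⊗ₜ[ℤ] M.obj.map f m)}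

/-- The tensor product `A ⊗_C M` of a `Cᵒᵖ`-module and a `C`-module. -/
abbrev Tensor (A : ModC Cᵒᵖ) (M : ModC C) : Type u :=
  (⨁ X : C, A.obj.obj (op X) ⊗[ℤ] M.obj.obj X) ⧸ tensorRel A M

/-- The map `α ⊗_C β`. -/
def tensorMap {A A' : ModC Cᵒᵖ} {M M' : ModC C} (α : A ⟶ A') (β : M ⟶ M') :
    Tensor A M →+ Tensor A' M' :=
  QuotientAddGroup.map _ _
    (DirectSum.map fun X : C => abTensorMap (α.hom.app (op X)) (β.hom.app X)) (by
      rw [tensorRel, AddSubgroup.closure_le]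
      rintro _ ⟨X, Y, f, a, m, rfl⟩
      refine AddSubgroup.subset_closure ⟨X, Y, f, α.hom.app (op Y) a, β.hom.app X m, ?_⟩
      rw [map_sub, DirectSum.map_of, DirectSum.map_of]
      have h1 : A'.obj.map f.op (α.hom.app (op Y) a) = α.hom.app (op X) (A.obj.map f.op a) :=
        (congrArg (fun k : A.obj.obj (op Y) ⟶ A'.obj.obj (op X) => k a)
          (α.hom.naturality f.op)).symm
      have h2 : M'.obj.map f (β.hom.app X m) = β.hom.app Y (M.obj.map f m) :=
        (congrArg (fun k : M.obj.obj X ⟶ M'.obj.obj Y => k m) (β.hom.naturality f)).symm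
      rw [h1, h2]
      rfl)

/-- Additive maps out of `A ⊗_C M` are determined by the elementary tensors. -/
theorem tensor_hom_ext {A : ModC Cᵒᵖ} {M : ModC C} {G : Type*} [AddCommGroup G]
    {φ ψ : Tensor A M →+ G}
    (h : ∀ (X : C) (a : A.obj.obj (op X)) (m : M.obj.obj X),
      open Classical in
      φ (QuotientAddGroup.mk (DirectSum.of (fun X : C => A.obj.obj (op X) ⊗[ℤ] M.obj.obj X) X
        (a ⊗ₜ[ℤ] m))) =
      ψ (QuotientAddGroup.mk (DirectSum.of (fun X : C => A.obj.obj (op X) ⊗[ℤ] M.obj.obj X) X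
        (a ⊗ₜ[ℤ] m)))) : φ = ψ := by
  classical
  apply QuotientAddGroup.addMonoidHom_ext
  apply DirectSum.addHom_ext
  intro X t
  induction t using TensorProduct.induction_on with
  | zero => simp
  | tmul a m =>
    exact h X a m
  | add x y hx hy => rw [map_add, map_add, map_add, hx, hy]

theorem tensorMap_mk {A A' : ModC Cᵒᵖ} {M M' : ModC C} (α : A ⟶ A') (β : M ⟶ M')
    (X : C) (a : A.obj.obj (op X)) (m : M.obj.obj X) :
    open Classical in
    tensorMap α β (QuotientAddGroup.mk
      (DirectSum.of (fun X : C => A.obj.obj (op X) ⊗[ℤ] M.obj.obj X) X (a ⊗ₜ[ℤ] m))) =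
    QuotientAddGroup.mk (DirectSum.of (fun X : C => A'.obj.obj (op X) ⊗[ℤ] M'.obj.obj X) X
      (α.hom.app (op X) a ⊗ₜ[ℤ] β.hom.app X m)) := by
  classical
  refine congrArg QuotientAddGroup.mk ?_
  exact DirectSum.map_of _ _ _

/-- `A ⊗_C M` as an object of the category of abelian groups. -/
def tensorGrp (A : ModC Cᵒᵖ) (M : ModC C) : AddCommGrpCat.{u} := AddCommGrpCat.of (Tensor A M)

/-- `α ⊗_C β` as a morphism of abelian groups. -/
def tensorHom {A A' : ModC Cᵒᵖ} {M M' : ModC C} (α : A ⟶ A') (β : M ⟶ M') :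
    tensorGrp A M ⟶ tensorGrp A' M' := AddCommGrpCat.ofHom (tensorMap α β)

theorem tensorHom_id (A : ModC Cᵒᵖ) (M : ModC C) :
    tensorHom (𝟙 A) (𝟙 M) = 𝟙 (tensorGrp A M) :=
  AddCommGrpCat.hom_ext <| tensor_hom_ext fun X a m => tensorMap_mk (𝟙 A) (𝟙 M) X a m

theorem tensorHom_comp {A A' A'' : ModC Cᵒᵖ} {M M' M'' : ModC C} (α : A ⟶ A') (β : M ⟶ M')
    (α' : A' ⟶ A'') (β' : M' ⟶ M'') :
    tensorHom (α ≫ α') (β ≫ β') = tensorHom α β ≫ tensorHom α' β' :=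
  AddCommGrpCat.hom_ext <| tensor_hom_ext fun X a m =>
    (tensorMap_mk (α ≫ α') (β ≫ β') X a m).trans
      ((congrArg (tensorMap α' β') (tensorMap_mk α β X a m)).trans
        (tensorMap_mk α' β' X _ _)).symm

theorem tensorHom_add_left {A A' : ModC Cᵒᵖ} {M M' : ModC C} (α α' : A ⟶ A') (β : M ⟶ M') :
    tensorHom (α + α') β = tensorHom α β + tensorHom α' β :=
  AddCommGrpCat.hom_ext <| tensor_hom_ext fun X a m => by
    change tensorMap (α + α') β _ = tensorMap α β _ + tensorMap α' β _
    rw [tensorMap_mk, tensorMap_mk, tensorMap_mk, ← QuotientAddGroup.mk_add, ← map_add,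
      ← TensorProduct.add_tmul]
    rfl

namespace CatIdeal

variable (I : CatIdeal C)

/-- The functor `X ↦ C(-, X) / I(-, X)` from `C / I` to `Cᵒᵖ`-modules. -/
def leftQuot : I.Quot ⥤ ModC Cᵒᵖ where
  obj X := AdditiveFunctor.of (I.proj.op ⋙ preadditiveYoneda.obj X)
  map f := ObjectProperty.homMk (Functor.whiskerLeft I.proj.op (preadditiveYoneda.map f))

instance leftQuot_additive : I.leftQuot.Additive where
  map_add {X Y f g} := by
    apply ObjectProperty.hom_ext
    ext Z h
    exact Preadditive.comp_add _ _ _ h f g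

/-- The `C/I`-module `C/I ⊗_C M`, `X ↦ (C(-, X) / I(-, X)) ⊗_C M`. -/
def quotTensorObj (M : ModC C) : I.Quot ⥤ AddCommGrpCat.{u} where
  obj X := tensorGrp (I.leftQuot.obj X) M
  map f := tensorHom (I.leftQuot.map f) (𝟙 M)
  map_id X := by rw [I.leftQuot.map_id, tensorHom_id]
  map_comp f g := by rw [← tensorHom_comp, I.leftQuot.map_comp, Category.comp_id]

instance quotTensorObj_additive (M : ModC C) : (I.quotTensorObj M).Additive where
  map_add {X Y f g} := by
    change tensorHom (I.leftQuot.map (f + g)) (𝟙 M) = _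
    rw [I.leftQuot.map_add, tensorHom_add_left]
    rfl

/-- The morphism `C/I ⊗_C β`. -/
def quotTensorMap {M M' : ModC C} (β : M ⟶ M') : I.quotTensorObj M ⟶ I.quotTensorObj M' where
  app X := tensorHom (𝟙 (I.leftQuot.obj X)) β
  naturality X Y f := by
    change tensorHom (I.leftQuot.map f) (𝟙 M) ≫ tensorHom (𝟙 _) β =
      tensorHom (𝟙 _) β ≫ tensorHom (I.leftQuot.map f) (𝟙 M')
    rw [← tensorHom_comp, ← tensorHom_comp, Category.comp_id, Category.comp_id,
      Category.id_comp, Category.id_comp]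

/-- The functor `C/I ⊗_C - : Mod(C) ⥤ Mod(C/I)`. -/
def quotTensor : ModC C ⥤ ModC I.Quot where
  obj M := AdditiveFunctor.of (I.quotTensorObj M)
  map β := ObjectProperty.homMk (I.quotTensorMap β)
  map_id M := ObjectProperty.hom_ext _ <| NatTrans.ext <| funext fun X => tensorHom_id _ M
  map_comp β β' := ObjectProperty.hom_ext _ <| NatTrans.ext <| funext fun X => by
    change tensorHom (𝟙 _) (β ≫ β') = tensorHom (𝟙 _) β ≫ tensorHom (𝟙 _) β'
    rw [← tensorHom_comp, Category.comp_id]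

end CatIdeal

end Tensor

/-! ### Hom functors -/

section HomFrom

variable {D : Type u} [Category.{u} D] [Preadditive D]
  {A : Type u₁} [Category.{u} A] [Preadditive A]

/-- For an additive contravariant functor `G` from `D` to `A`, the functor
`A ⥤ Mod(D)`, `N ↦ Hom_A(G(-), N)`. -/
def homFrom (G : Dᵒᵖ ⥤ A) [G.Additive] : A ⥤ ModC D :=
  (additiveFunctor D AddCommGrpCat.{u}).lift
    (preadditiveYoneda ⋙ (Functor.whiskeringLeft _ _ _).obj G.rightOp)
    (fun N =>
      { map_add := fun {X Y f g} => by
          refine AddCommGrpCat.hom_ext (AddMonoidHom.ext fun h : G.obj (op X) ⟶ N => ?_)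
          change G.map (f + g).op ≫ h = G.map f.op ≫ h + G.map g.op ≫ h
          rw [op_add, G.map_add, Preadditive.add_comp] })

end HomFrom

section SixFunctors

variable {C : Type u} [Category.{u} C] [Preadditive C]

/-- The functor `C(C/I, -) : Mod(C) ⥤ Mod(C/I)`,
`C(C/I, M)(X) = Hom_{Mod(C)}(C(X, -) / I(X, -), M)`; here `C(X, -) / I(X, -)` is
`π_*(Hom_{C/I}(X, -))`. -/
def CatIdeal.quotHom (I : CatIdeal C) : ModC C ⥤ ModC I.Quot :=
  homFrom (repFunctor I.Quot ⋙ I.piStar)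

variable (P : ModC C)

/-- The ring `R_P = End(P)ᵒᵖ`. -/
abbrev RP : Type u := (End P)ᵐᵒᵖ

/-- The functor `Hom_{Mod(C)}(P, -) : Mod(C) ⥤ Mod(R_P)`. -/
abbrev homP : ModC C ⥤ ModuleCat.{u} (RP P) := preadditiveCoyonedaObj P

/-- The functor `Hom_{R_P}(P^*, -) : Mod(R_P) ⥤ Mod(C)`, `N ↦ Hom_{R_P}(P^*(-), N)`, where
`P^*(X)` is the `R_P`-module `Hom_{Mod(C)}(P, Hom_C(X, -))`. -/
def homPStar : ModuleCat.{u} (RP P) ⥤ ModC C :=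
  homFrom (repFunctor C ⋙ homP P)

/-- The relations `p·φ ⊗ n = p ⊗ φ·n` of the tensor product `P(X) ⊗_{R_P} N`; the right action of
`φ ∈ R_P` on `p ∈ P(X)` is evaluation of the endomorphism `φ` of `P`. -/
def tensorPRel (X : C) (N : ModuleCat.{u} (RP P)) : AddSubgroup (P.obj.obj X ⊗[ℤ] N) :=
  AddSubgroup.closure {z | ∃ (φ : End P) (p : P.obj.obj X) (n : N),
    z = ((φ : P ⟶ P).hom.app X p) ⊗ₜ[ℤ] n - p ⊗ₜ[ℤ] (MulOpposite.op φ • n)}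

/-- The abelian group `P(X) ⊗_{R_P} N`. -/
abbrev TensorP (X : C) (N : ModuleCat.{u} (RP P)) : Type u :=
  (P.obj.obj X ⊗[ℤ] N) ⧸ tensorPRel P X N

variable {P}

/-- The map `P(f) ⊗ g`. -/
def tensorPMap {X Y : C} {N N' : ModuleCat.{u} (RP P)} (f : X ⟶ Y) (g : N ⟶ N') :
    TensorP P X N →+ TensorP P Y N' :=
  QuotientAddGroup.map _ _
    (TensorProduct.map (P.obj.map f).hom.toIntLinearMap
      g.hom.toAddMonoidHom.toIntLinearMap).toAddMonoidHom (by
      rw [tensorPRel, AddSubgroup.closure_le]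
      rintro _ ⟨φ, p, n, rfl⟩
      refine AddSubgroup.subset_closure ⟨φ, P.obj.map f p, g.hom n, ?_⟩
      have h1 : (φ : P ⟶ P).hom.app Y (P.obj.map f p) =
          P.obj.map f ((φ : P ⟶ P).hom.app X p) :=
        congrArg (fun k : P.obj.obj X ⟶ P.obj.obj Y => k p) ((φ : P ⟶ P).hom.naturality f)
      rw [h1, ← map_smul]
      rw [map_sub]
      rfl)

theorem tensorP_hom_ext {X : C} {N : ModuleCat.{u} (RP P)} {G : Type*} [AddCommGroup G]
    {φ ψ : TensorP P X N →+ G}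
    (h : ∀ (p : P.obj.obj X) (n : N),
      φ (QuotientAddGroup.mk (p ⊗ₜ[ℤ] n)) = ψ (QuotientAddGroup.mk (p ⊗ₜ[ℤ] n))) : φ = ψ := by
  apply QuotientAddGroup.addMonoidHom_ext
  ext t
  induction t using TensorProduct.induction_on with
  | zero => simp
  | tmul p n => exact h p n
  | add x y hx hy => rw [map_add, map_add, hx, hy]

theorem tensorPMap_mk {X Y : C} {N N' : ModuleCat.{u} (RP P)} (f : X ⟶ Y) (g : N ⟶ N')
    (p : P.obj.obj X) (n : N) :
    tensorPMap f g (QuotientAddGroup.mk (p ⊗ₜ[ℤ] n)) =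
      QuotientAddGroup.mk (P.obj.map f p ⊗ₜ[ℤ] g.hom n) := rfl

variable (P) in
/-- `P(X) ⊗_{R_P} N` as an object of the category of abelian groups. -/
def tensorPGrp (X : C) (N : ModuleCat.{u} (RP P)) : AddCommGrpCat.{u} :=
  AddCommGrpCat.of (TensorP P X N)

/-- `P(f) ⊗ g` as a morphism of abelian groups. -/
def tensorPHom {X Y : C} {N N' : ModuleCat.{u} (RP P)} (f : X ⟶ Y) (g : N ⟶ N') :
    tensorPGrp P X N ⟶ tensorPGrp P Y N' := AddCommGrpCat.ofHom (tensorPMap f g)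

theorem tensorPHom_id (X : C) (N : ModuleCat.{u} (RP P)) :
    tensorPHom (𝟙 X) (𝟙 N) = 𝟙 (tensorPGrp P X N) :=
  AddCommGrpCat.hom_ext <| tensorP_hom_ext fun p n => by
    change tensorPMap (𝟙 X) (𝟙 N) _ = _
    rw [tensorPMap_mk, P.obj.map_id]
    rfl

theorem tensorPHom_comp {X Y Z : C} {N N' N'' : ModuleCat.{u} (RP P)} (f : X ⟶ Y) (g : N ⟶ N')
    (f' : Y ⟶ Z) (g' : N' ⟶ N'') :
    tensorPHom (f ≫ f') (g ≫ g') = tensorPHom f g ≫ tensorPHom f' g' :=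
  AddCommGrpCat.hom_ext <| tensorP_hom_ext fun p n => by
    refine (tensorPMap_mk (f ≫ f') (g ≫ g') p n).trans
      (Eq.trans ?_ ((congrArg (tensorPMap f' g') (tensorPMap_mk f g p n)).trans
        (tensorPMap_mk f' g' _ _)).symm)
    rw [P.obj.map_comp]
    rfl

theorem tensorPHom_add_left {X Y : C} {N N' : ModuleCat.{u} (RP P)} (f f' : X ⟶ Y)
    (g : N ⟶ N') : tensorPHom (f + f') g = tensorPHom f g + tensorPHom f' g :=
  AddCommGrpCat.hom_ext <| tensorP_hom_ext fun p n => by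
    change tensorPMap (f + f') g _ = tensorPMap f g _ + tensorPMap f' g _
    rw [tensorPMap_mk, tensorPMap_mk, tensorPMap_mk, ← QuotientAddGroup.mk_add,
      ← TensorProduct.add_tmul, P.obj.map_add]
    rfl

variable (P)

/-- The `C`-module `P ⊗_{R_P} N`, `X ↦ P(X) ⊗_{R_P} N`. -/
def tensorPObj (N : ModuleCat.{u} (RP P)) : C ⥤ AddCommGrpCat.{u} where
  obj X := tensorPGrp P X N
  map f := tensorPHom f (𝟙 N)
  map_id X := tensorPHom_id X N
  map_comp f g := by rw [← tensorPHom_comp, Category.comp_id]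

instance tensorPObj_additive (N : ModuleCat.{u} (RP P)) : (tensorPObj P N).Additive where
  map_add {_ _ f g} := tensorPHom_add_left f g (𝟙 N)

/-- The morphism `P ⊗_{R_P} β`. -/
def tensorPObjMap {N N' : ModuleCat.{u} (RP P)} (β : N ⟶ N') :
    tensorPObj P N ⟶ tensorPObj P N' where
  app X := tensorPHom (𝟙 X) β
  naturality X Y f := by
    change tensorPHom f (𝟙 N) ≫ tensorPHom (𝟙 _) β = tensorPHom (𝟙 _) β ≫ tensorPHom f (𝟙 N')
    rw [← tensorPHom_comp, ← tensorPHom_comp, Category.comp_id, Category.comp_id,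
      Category.id_comp, Category.id_comp]

/-- The functor `P ⊗_{R_P} - : Mod(R_P) ⥤ Mod(C)`. -/
def tensorP : ModuleCat.{u} (RP P) ⥤ ModC C where
  obj N := AdditiveFunctor.of (tensorPObj P N)
  map β := ObjectProperty.homMk (tensorPObjMap P β)
  map_id N := ObjectProperty.hom_ext _ <| NatTrans.ext <| funext fun X => tensorPHom_id X N
  map_comp β β' := ObjectProperty.hom_ext _ <| NatTrans.ext <| funext fun X => by
    change tensorPHom (𝟙 _) (β ≫ β') = tensorPHom (𝟙 _) β ≫ tensorPHom (𝟙 _) β'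
    rw [← tensorPHom_comp, Category.comp_id]

end SixFunctors

/-! ### Recollements -/

section Recollement

/-- A preadditive category is abelian. -/
structure IsAbelianCat (A : Type u₁) [Category.{v₁} A] [Preadditive A] : Prop where
  hasFiniteProducts : HasFiniteProducts A
  hasKernels : HasKernels A
  hasCokernels : HasCokernels A
  isNormalMono : IsNormalMonoCategory A
  isNormalEpi : IsNormalEpiCategory A

variable {B : Type u₁} [Category.{v₁} B] [Preadditive B]
  {A : Type u₂} [Category.{v₂} A] [Preadditive A]
  {D : Type u₃} [Category.{v₃} D] [Preadditive D]

/-- The six functors `i^* ⊣ i_* ⊣ i^!` between `B` and `A`, and `j_! ⊣ j^* ⊣ j_*` between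
`D` and `A`, form a recollement of abelian categories. -/
structure IsRecollement (iUpperStar : A ⥤ B) (iStar : B ⥤ A) (iShriek : A ⥤ B)
    (jShriek : D ⥤ A) (jUpperStar : A ⥤ D) (jStar : D ⥤ A) : Prop where
  abelian_left : IsAbelianCat B
  abelian_middle : IsAbelianCat A
  abelian_right : IsAbelianCat D
  additive_iUpperStar : iUpperStar.Additive
  additive_iStar : iStar.Additive
  additive_iShriek : iShriek.Additive
  additive_jShriek : jShriek.Additive
  additive_jUpperStar : jUpperStar.Additive
  additive_jStar : jStar.Additive
  adj_i : Nonempty (iUpperStar ⊣ iStar)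
  adj_i' : Nonempty (iStar ⊣ iShriek)
  adj_j : Nonempty (jShriek ⊣ jUpperStar)
  adj_j' : Nonempty (jUpperStar ⊣ jStar)
  comp_zero : ∀ X : B, IsZero (jUpperStar.obj (iStar.obj X))
  full_iStar : iStar.Full
  faithful_iStar : iStar.Faithful
  full_jShriek : jShriek.Full
  faithful_jShriek : jShriek.Faithful
  full_jStar : jStar.Full
  faithful_jStar : jStar.Faithful

end Recollement

/-- The restriction of a functor to full subcategories that it preserves. -/
abbrev restrict {A : Type u₁} [Category.{v₁} A] {B : Type u₂} [Category.{v₂} B]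
    (S : ObjectProperty A) (T : ObjectProperty B) (F : A ⥤ B)
    (h : ∀ X : A, S X → T (F.obj X)) : S.FullSubcategory ⥤ T.FullSubcategory :=
  T.lift (S.ι ⋙ F) (fun X => h X.obj X.property)

end DualizingVariety

end

open DualizingVariety

noncomputable section

open ZeroObject

namespace DualizingVariety

/-! ### `Mod(C)` as an abelian category -/

section AbelianMod

/-! Write `P = C(c, -)` and `I = I_B`. By Yoneda `Hom(P, M)` is `M(c)` and `P^*(X)` is `C(X, c)`.
All four adjunctions already hold between the full module categories, and an adjunction restricts to
full subcategories that both functors preserve. Likewise `π_*` is fully faithful because `π` is full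
and bijective on objects; `P ⊗ -` is, because `P(c) ⊗ N ≅ N` makes its unit invertible; and the
other adjoint of `Hom(P, -)` is, because it lies in an adjoint triple with `P ⊗ -`. Finally `Hom(P,
π_* F) = F(πc) = 0`, since `1_c` lies in `I`. What remains is that the three small categories are
abelian and that the functors preserve them.

Abelian: `mod(C)` is always closed under cokernels and finite products in `Mod(C)`. Closure under
kernels is where the duality `D` enters (`IsDuality.isClosedUnderKernels`): the kernel of `f` is the
module whose dual is the cokernel of `D f`, and this can be checked on elements because these are
morphisms from representables, which are finitely presented. For `C/I` one transfers kernels along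
`π_*`, which preserves and reflects finite presentation. The ring `R_P` is a finitely generated
module over the image of `R`, hence noetherian.

Preservation: `C/I ⊗ -`, `π_*`, `Hom(P, -)` and `P ⊗ -` are left adjoints, hence right exact, so it
suffices to look at representables and free modules. For `π_*` this uses that `I(X, -)` is generated
by one morphism `X ⟶ cⁿ`, a left `add(c)`-approximation (`exists_approximation`).

The hard case is `Hom_{R_P}(P^*, N)` (`IsDuality.isFP_homPStar`). The idea is that `D` exchanges the
left adjoint over `Cᵒᵖ` with the right adjoint over `C`. Put `M = P ⊗ N`, `A = D M`, and let `T ⟶ A`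
be the counit of the tensor-hom adjunction of `C(-, c)` over `Cᵒᵖ`. Then `T ≅ D M'` with `M'`
finitely presented, and the counit comes from a map `M ⟶ M'` which is bijective at `c`. Since `T`
lies in the image of the left adjoint, `M'` lies in that of the right adjoint, and so `M' ≅
Hom_{R_P}(P^*, N)`.

Last, `π_* C(C/I, M)` consists of the elements of `M` killed by all morphisms to `c`, which is the
kernel of the unit `M ⟶ Hom_{R_P}(P^*, Hom(P, M))`. It is finitely presented by the previous case
and closure under kernels (`isFP_quotHom`). -/

instance additiveFunctor_isClosedUnderLimitsOfShape {C : Type u₁} [Category.{v₁} C]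
    [Preadditive C] {D : Type u₂} [Category.{v₂} D] [Preadditive D]
    (J : Type u₃) [Category.{v₃} J] [HasLimitsOfShape J D] :
    (additiveFunctor C D).IsClosedUnderLimitsOfShape J where
  limitsOfShape_le := by
    rintro F ⟨p⟩
    refine ⟨fun {X Y f g} => ?_⟩
    refine (isLimitOfPreserves ((evaluation C D).obj Y) p.isLimit).hom_ext fun j => ?_
    have := p.prop_diag_obj j
    rw [additiveFunctor_iff] at this
    let α : F ⟶ p.diag.obj j := p.π.app j
    change F.map (f + g) ≫ α.app Y = (F.map f + F.map g) ≫ α.app Y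
    rw [Preadditive.add_comp, α.naturality, α.naturality, α.naturality, Functor.map_add,
      Preadditive.comp_add]

instance additiveFunctor_isClosedUnderSubobjects {C : Type u₁} [Category.{v₁} C]
    [Preadditive C] {D : Type u₂} [Category.{v₂} D] [Preadditive D] [HasPullbacks D] :
    (additiveFunctor C D).IsClosedUnderSubobjects where
  prop_of_mono {F G} i _ hG := by
    rw [additiveFunctor_iff] at hG ⊢
    refine ⟨fun {X Y f g} => ?_⟩
    have := (NatTrans.mono_iff_mono_app i).1 inferInstance Y
    rw [← cancel_mono (i.app Y), Preadditive.add_comp, i.naturality, i.naturality, i.naturality,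
      Functor.map_add, Preadditive.comp_add]

instance additiveFunctor_isClosedUnderQuotients {C : Type u₁} [Category.{v₁} C]
    [Preadditive C] {D : Type u₂} [Category.{v₂} D] [Preadditive D] [HasPushouts D] :
    (additiveFunctor C D).IsClosedUnderQuotients where
  prop_of_epi {F G} i _ hG := by
    rw [additiveFunctor_iff] at hG ⊢
    refine ⟨fun {X Y f g} => ?_⟩
    have := (NatTrans.epi_iff_epi_app i).1 inferInstance X
    rw [← cancel_epi (i.app X), Preadditive.comp_add, ← i.naturality, ← i.naturality,
      ← i.naturality, Functor.map_add, Preadditive.add_comp]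

instance additiveFunctor_containsZero {C : Type u₁} [Category.{v₁} C]
    [Preadditive C] {D : Type u₂} [Category.{v₂} D] [Preadditive D] [HasZeroObject D] :
    (additiveFunctor C D).ContainsZero where
  exists_zero := ⟨0, isZero_zero _, .of_isZero (isZero_zero _)⟩

instance additiveFunctor_isClosedUnderFiniteProducts {C : Type u₁} [Category.{v₁} C]
    [Preadditive C] {D : Type u₂} [Category.{v₂} D] [Preadditive D] [HasFiniteProducts D] :
    (additiveFunctor C D).IsClosedUnderFiniteProducts where
  isClosedUnderLimitsOfShape _ _ := inferInstance

variable {C : Type u} [Category.{u} C] [Preadditive C]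

/-- Additive functors contain zero and are closed under finite products, subobjects and quotients
among all functors, so kernels and cokernels are inherited from the functor category and are
computed objectwise. -/
instance modAbelian : Abelian (ModC C) :=
  inferInstanceAs (Abelian (additiveFunctor C AddCommGrpCat.{u}).FullSubcategory)

/-- Evaluation of `C`-modules at an object. -/
def ev (X : C) : ModC C ⥤ AddCommGrpCat.{u} :=
  (additiveFunctor C AddCommGrpCat.{u}).ι ⋙ (evaluation C AddCommGrpCat.{u}).obj X

instance ev_additive (X : C) : (ev X).Additive where

instance ev_preservesFiniteLimits (X : C) : PreservesFiniteLimits (ev X) := by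
  have : PreservesFiniteLimits (additiveFunctor C AddCommGrpCat.{u}).ι := by
    have := (additiveFunctor C AddCommGrpCat.{u}).preservesKernels_ι
    exact Functor.preservesFiniteLimits_of_preservesKernels _
  exact comp_preservesFiniteLimits _ _

instance ev_preservesFiniteColimits (X : C) : PreservesFiniteColimits (ev X) := by
  have : PreservesFiniteColimits (additiveFunctor C AddCommGrpCat.{u}).ι := by
    have := (additiveFunctor C AddCommGrpCat.{u}).preservesCokernels_ι
    exact Functor.preservesFiniteColimits_of_preservesCokernels _
  exact comp_preservesFiniteColimits _ _

theorem naturality_apply {M N : ModC C} (α : M ⟶ N) {X Y : C} (f : X ⟶ Y) (m : M.obj.obj X) :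
    α.hom.app Y (M.obj.map f m) = N.obj.map f (α.hom.app X m) :=
  congrArg (fun k : M.obj.obj X ⟶ N.obj.obj Y => k m) (α.hom.naturality f)

theorem map_comp_apply (M : ModC C) {X Y Z : C} (f : X ⟶ Y) (g : Y ⟶ Z) (m : M.obj.obj X) :
    M.obj.map (f ≫ g) m = M.obj.map g (M.obj.map f m) := by
  rw [M.obj.map_comp]
  rfl

theorem map_id_apply (M : ModC C) {X : C} (m : M.obj.obj X) : M.obj.map (𝟙 X) m = m := by
  rw [M.obj.map_id]
  rfl

theorem map_add_apply (M : ModC C) {X Y : C} (f g : X ⟶ Y) (m : M.obj.obj X) :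
    M.obj.map (f + g) m = M.obj.map f m + M.obj.map g m := by
  rw [Functor.map_add]
  rfl

theorem map_sub_apply (M : ModC C) {X Y : C} (f g : X ⟶ Y) (m : M.obj.obj X) :
    M.obj.map (f - g) m = M.obj.map f m - M.obj.map g m := by
  rw [Functor.map_sub]
  rfl

theorem map_zero_apply (M : ModC C) {X Y : C} (m : M.obj.obj X) :
    M.obj.map (0 : X ⟶ Y) m = 0 := by
  rw [Functor.map_zero]
  rfl

@[ext]
theorem mod_hom_ext {M N : ModC C} {α β : M ⟶ N}
    (h : ∀ (X : C) (m : M.obj.obj X), α.hom.app X m = β.hom.app X m) : α = β :=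
  ObjectProperty.hom_ext _ <| NatTrans.ext <| funext fun X =>
    AddCommGrpCat.hom_ext <| AddMonoidHom.ext <| h X

/-- A constructor for morphisms of `C`-modules. -/
def modHomMk {M N : ModC C} (φ : ∀ X : C, M.obj.obj X →+ N.obj.obj X)
    (h : ∀ {X Y : C} (f : X ⟶ Y) (m : M.obj.obj X), φ Y (M.obj.map f m) = N.obj.map f (φ X m)) :
    M ⟶ N :=
  ObjectProperty.homMk
    { app := fun X => AddCommGrpCat.ofHom (φ X)
      naturality := fun _ _ f => AddCommGrpCat.hom_ext <| AddMonoidHom.ext <| h f }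

theorem isIso_of_bijective {M N : ModC C} (α : M ⟶ N)
    (h : ∀ X : C, Function.Bijective (α.hom.app X)) : IsIso α := by
  rw [← ObjectProperty.isIso_hom_iff, NatTrans.isIso_iff_isIso_app]
  intro X
  exact (ConcreteCategory.isIso_iff_bijective _).2 (h X)

theorem bijective_of_isIso {M N : ModC C} (α : M ⟶ N) [IsIso α] (X : C) :
    Function.Bijective (α.hom.app X) :=
  (ConcreteCategory.isIso_iff_bijective ((ev X).map α)).1 inferInstance

theorem cokernel_exact {M N : ModC C} (f : M ⟶ N) (X : C) :
    Function.Exact (f.hom.app X) ((cokernel.π f).hom.app X) :=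
  (ShortComplex.ab_exact_iff_function_exact _).1
    ((ShortComplex.exact_cokernel f).map (ev X))

theorem surjective_of_epi {M N : ModC C} (f : M ⟶ N) [Epi f] (X : C) :
    Function.Surjective (f.hom.app X) :=
  (AddCommGrpCat.epi_iff_surjective ((ev X).map f)).1 inferInstance

theorem injective_of_mono {M N : ModC C} (f : M ⟶ N) [Mono f] (X : C) :
    Function.Injective (f.hom.app X) :=
  (AddCommGrpCat.mono_iff_injective ((ev X).map f)).1 inferInstance

/-- Turns the objectwise presentations of `IsFP` into categorical cokernels, to which right exact
functors can be applied. -/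
theorem isIso_cokernel_desc {M N Q : ModC C} (f : M ⟶ N) (g : N ⟶ Q) (w : f ≫ g = 0)
    (h : ∀ X, Function.Exact (f.hom.app X) (g.hom.app X))
    (h' : ∀ X, Function.Surjective (g.hom.app X)) : IsIso (cokernel.desc f g w) := by
  have key : ∀ (X : C) (n : N.obj.obj X),
      (cokernel.desc f g w).hom.app X ((cokernel.π f).hom.app X n) = g.hom.app X n :=
    fun X n => congrArg (fun k : N ⟶ Q => k.hom.app X n) (cokernel.π_desc f g w)
  refine isIso_of_bijective _ fun X => ⟨?_, fun q => ?_⟩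
  · refine (injective_iff_map_eq_zero ((cokernel.desc f g w).hom.app X).hom).2 fun z hz => ?_
    obtain ⟨n, rfl⟩ := surjective_of_epi (cokernel.π f) X z
    exact (cokernel_exact f X n).2 ((h X n).1 ((key X n).symm.trans hz))
  · obtain ⟨n, rfl⟩ := h' X q
    exact ⟨_, key X n⟩

end AbelianMod

/-! ### The Yoneda lemma -/

section Yoneda

variable {C : Type u} [Category.{u} C] [Preadditive C]

/-- The morphism `Hom_C(X, -) ⟶ M` corresponding to an element of `M(X)`. -/
def repHom {M : ModC C} {X : C} (m : M.obj.obj X) : rep X ⟶ M :=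
  modHomMk
    (fun Y =>
      { toFun := fun g : X ⟶ Y => M.obj.map g m
        map_zero' := map_zero_apply M m
        map_add' := fun g g' => map_add_apply M g g' m })
    (fun f g => map_comp_apply M g f m)

theorem rep_hom_app {M : ModC C} {X : C} (α : rep X ⟶ M) {Y : C} (g : X ⟶ Y) :
    α.hom.app Y g = M.obj.map g (α.hom.app X (𝟙 X)) :=
  (congrArg (α.hom.app Y) (Category.id_comp g).symm).trans
    (naturality_apply α g (show (rep X).obj.obj X from 𝟙 X))

theorem rep_hom_ext {M : ModC C} {X : C} {α β : rep X ⟶ M}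
    (h : α.hom.app X (𝟙 X) = β.hom.app X (𝟙 X)) : α = β := by
  apply mod_hom_ext
  intro Y (g : X ⟶ Y)
  rw [rep_hom_app α, rep_hom_app β, h]

theorem repHom_app_id {M : ModC C} {X : C} (m : M.obj.obj X) :
    (repHom m).hom.app X (𝟙 X) = m := map_id_apply M m

theorem repHom_comp {M N : ModC C} {X : C} (m : M.obj.obj X) (α : M ⟶ N) :
    repHom m ≫ α = repHom (α.hom.app X m) :=
  rep_hom_ext ((congrArg (α.hom.app X) (repHom_app_id m)).trans (repHom_app_id _).symm)

/-- The Yoneda lemma. -/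
def repEquiv (X : C) (M : ModC C) : (rep X ⟶ M) ≃+ M.obj.obj X where
  toFun α := α.hom.app X (𝟙 X)
  invFun m := repHom m
  left_inv _ := rep_hom_ext (repHom_app_id _)
  right_inv := repHom_app_id
  map_add' _ _ := rfl

end Yoneda

/-! ### Finitely presented modules -/

section FinitelyPresented

variable {C : Type u} [Category.{u} C] [Preadditive C]

/-- A module is finitely presented if it has one generator `m ∈ M(X₁)`, whose relations are the
multiples of one morphism `b : X₁ ⟶ X₀`. -/
theorem isFP_iff (M : ModC C) : IsFP C M ↔
    ∃ (X₁ X₀ : C) (b : X₁ ⟶ X₀) (m : M.obj.obj X₁), ∀ Y : C,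
      (∀ y : M.obj.obj Y, ∃ g : X₁ ⟶ Y, M.obj.map g m = y) ∧
      ∀ g : X₁ ⟶ Y, M.obj.map g m = 0 ↔ ∃ k : X₀ ⟶ Y, b ≫ k = g := by
  constructor
  · rintro ⟨X₀, X₁, f, g, h⟩
    refine ⟨X₁, X₀, f.hom.app X₀ (𝟙 X₀), g.hom.app X₁ (𝟙 X₁), fun Y => ⟨fun y => ?_, fun k => ?_⟩⟩
    · obtain ⟨k, hk⟩ := (h Y).2 y
      exact ⟨k, (rep_hom_app g k).symm.trans hk⟩
    · rw [← rep_hom_app g k, (h Y).1 k]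
      refine exists_congr fun k' => ?_
      rw [rep_hom_app f k']
      rfl
  · rintro ⟨X₁, X₀, b, m, h⟩
    exact ⟨X₀, X₁, repHom (M := rep X₁) b, repHom m,
      fun Y => ⟨fun k => (h Y).2 k, fun y => (h Y).1 y⟩⟩

theorem isFP_rep [HasZeroObject C] (X : C) : IsFP C (rep X) := by
  refine (isFP_iff _).2 ⟨X, 0, 0, 𝟙 X, fun Y => ⟨fun y => ⟨y, Category.id_comp _⟩, fun g => ?_⟩⟩
  change 𝟙 X ≫ g = 0 ↔ _
  simp [eq_comm]

instance isFP_isClosedUnderIsomorphisms : (IsFP C).IsClosedUnderIsomorphisms where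
  of_iso {M N} e := by
    rintro ⟨X₀, X₁, f, g, h⟩
    refine ⟨X₀, X₁, f, g ≫ e.hom, fun Y => ⟨fun k => ?_, ?_⟩⟩
    · rw [← (h Y).1 k]
      exact map_eq_zero_iff (e.hom.hom.app Y).hom (bijective_of_isIso e.hom Y).1
    · exact (bijective_of_isIso e.hom Y).2.comp (h Y).2

/-- The cokernel of a morphism from a finitely generated to a finitely presented module is
finitely presented. -/
theorem isFP_of_exact [HasBinaryBiproducts C] {M N Q : ModC C} (f : M ⟶ N) (g : N ⟶ Q)
    (h : ∀ Y, Function.Exact (f.hom.app Y) (g.hom.app Y))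
    (h' : ∀ Y, Function.Surjective (g.hom.app Y))
    {X : C} (x : M.obj.obj X) (hx : ∀ (Y : C) (y : M.obj.obj Y), ∃ k : X ⟶ Y, M.obj.map k x = y)
    (hN : IsFP C N) : IsFP C Q := by
  obtain ⟨B₁, B₀, b, n, hn⟩ := (isFP_iff N).1 hN
  -- `a` writes the image of the generator of `M` as a multiple of the generator `n` of `N`. The
  -- relations of `Q` are those of `N`, given by `b`, together with `a`.
  obtain ⟨a, ha⟩ := (hn X).1 (f.hom.app X x)
  refine (isFP_iff Q).2 ⟨B₁, X ⊞ B₀, biprod.lift a b, g.hom.app B₁ n, fun Y => ⟨fun y => ?_, ?_⟩⟩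
  · obtain ⟨y, rfl⟩ := h' Y y
    obtain ⟨k, rfl⟩ := (hn Y).1 y
    exact ⟨k, (naturality_apply g k n).symm⟩
  · intro k
    rw [← naturality_apply, h Y]
    constructor
    · rintro ⟨y, hy⟩
      obtain ⟨l, rfl⟩ := hx Y y
      rw [naturality_apply, ← ha, ← map_comp_apply, eq_comm, ← sub_eq_zero, ← map_sub_apply,
        (hn Y).2] at hy
      obtain ⟨z, hz⟩ := hy
      refine ⟨biprod.desc l z, ?_⟩
      rw [biprod.lift_desc, hz, add_sub_cancel]
    · rintro ⟨z, rfl⟩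
      refine ⟨M.obj.map (biprod.inl ≫ z) x, ?_⟩
      rw [naturality_apply, ← ha, ← map_comp_apply, eq_comm, ← sub_eq_zero, ← map_sub_apply,
        (hn Y).2]
      refine ⟨biprod.inr ≫ z, ?_⟩
      have : biprod.lift a b = a ≫ biprod.inl + b ≫ biprod.inr := by ext <;> simp
      rw [this]
      simp

theorem isFP_cokernel [HasBinaryBiproducts C] {M N : ModC C} (f : M ⟶ N) (hM : IsFP C M)
    (hN : IsFP C N) : IsFP C (cokernel f) := by
  obtain ⟨X₁, X₀, b, m, hm⟩ := (isFP_iff M).1 hM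
  exact isFP_of_exact f (cokernel.π f) (cokernel_exact f) (surjective_of_epi _) m
    (fun Y => (hm Y).1) hN

instance isFP_isClosedUnderCokernels [HasBinaryBiproducts C] :
    (IsFP C).IsClosedUnderCokernels where
  cokernels_le := by
    rintro _ ⟨f, k, hk, hf⟩
    exact (IsFP C).prop_of_iso
      ((cokernelIsCokernel f).coconePointUniqueUpToIso hk) (isFP_cokernel f hf.1 hf.2)

instance isFP_containsZero [HasZeroObject C] : (IsFP C).ContainsZero where
  exists_zero := by
    refine ⟨rep 0, ?_, isFP_rep _⟩
    rw [IsZero.iff_id_eq_zero]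
    exact rep_hom_ext ((isZero_zero C).eq_of_src _ _)

/-- The direct sum of two presentations is again of the required form, because biproducts in `C`
represent direct sums of representables. -/
theorem isFP_biprod [HasBinaryBiproducts C] {M N : ModC C} (hM : IsFP C M) (hN : IsFP C N) :
    IsFP C (M ⊞ N) := by
  obtain ⟨X₁, X₀, b, m, hm⟩ := (isFP_iff M).1 hM
  obtain ⟨Y₁, Y₀, d, n, hn⟩ := (isFP_iff N).1 hN
  let i : M ⟶ M ⊞ N := biprod.inl
  let j : N ⟶ M ⊞ N := biprod.inr
  -- The generator is the pair `(m, n)`, with both components pushed forward to `X₁ ⊞ Y₁`; `g` acts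
  -- on it through its two restrictions.
  have key : ∀ {Z : C} (g : X₁ ⊞ Y₁ ⟶ Z), (M ⊞ N).obj.map g
      ((M ⊞ N).obj.map biprod.inl (i.hom.app X₁ m) + (M ⊞ N).obj.map biprod.inr (j.hom.app Y₁ n)) =
      i.hom.app Z (M.obj.map (biprod.inl ≫ g) m) +
        j.hom.app Z (N.obj.map (biprod.inr ≫ g) n) := fun g => by
    rw [map_add, ← map_comp_apply, ← map_comp_apply, naturality_apply, naturality_apply]
  have total : ∀ {Z : C} (z : (M ⊞ N).obj.obj Z),
      i.hom.app Z ((biprod.fst : M ⊞ N ⟶ M).hom.app Z z) +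
        j.hom.app Z ((biprod.snd : M ⊞ N ⟶ N).hom.app Z z) = z := fun {Z} z =>
    congrArg (fun k : M ⊞ N ⟶ M ⊞ N => k.hom.app Z z) (biprod.total (X := M) (Y := N))
  have split : ∀ {Z : C} (x : M.obj.obj Z) (y : N.obj.obj Z),
      i.hom.app Z x + j.hom.app Z y = 0 → x = 0 ∧ y = 0 := fun {Z} x y hxy => by
    constructor
    · have h := congrArg ((biprod.fst : M ⊞ N ⟶ M).hom.app Z) hxy
      rw [map_add, map_zero] at h
      have h₁ := congrArg (fun k : M ⟶ M => k.hom.app Z x) (biprod.inl_fst (X := M) (Y := N))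
      have h₂ := congrArg (fun k : N ⟶ M => k.hom.app Z y) (biprod.inr_fst (X := M) (Y := N))
      exact (add_zero x).symm.trans ((congrArg₂ (· + ·) h₁ h₂).symm.trans h)
    · have h := congrArg ((biprod.snd : M ⊞ N ⟶ N).hom.app Z) hxy
      rw [map_add, map_zero] at h
      have h₁ := congrArg (fun k : M ⟶ N => k.hom.app Z x) (biprod.inl_snd (X := M) (Y := N))
      have h₂ := congrArg (fun k : N ⟶ N => k.hom.app Z y) (biprod.inr_snd (X := M) (Y := N))
      exact (zero_add y).symm.trans ((congrArg₂ (· + ·) h₁ h₂).symm.trans h)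
  refine (isFP_iff _).2 ⟨X₁ ⊞ Y₁, X₀ ⊞ Y₀, biprod.map b d,
    (M ⊞ N).obj.map biprod.inl (i.hom.app X₁ m) + (M ⊞ N).obj.map biprod.inr (j.hom.app Y₁ n),
    fun Z => ⟨fun z => ?_, fun g => ?_⟩⟩
  · obtain ⟨p, hp⟩ := (hm Z).1 ((biprod.fst : M ⊞ N ⟶ M).hom.app Z z)
    obtain ⟨q, hq⟩ := (hn Z).1 ((biprod.snd : M ⊞ N ⟶ N).hom.app Z z)
    refine ⟨biprod.desc p q, ?_⟩
    rw [key, biprod.inl_desc, biprod.inr_desc, hp, hq, total]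
  · rw [key]
    constructor
    · intro h
      obtain ⟨h₁, h₂⟩ := split _ _ h
      obtain ⟨p, hp⟩ := ((hm Z).2 _).1 h₁
      obtain ⟨q, hq⟩ := ((hn Z).2 _).1 h₂
      exact ⟨biprod.desc p q, by ext <;> simp [hp, hq]⟩
    · rintro ⟨k, rfl⟩
      rw [((hm Z).2 _).2 ⟨biprod.inl ≫ k, by simp⟩, ((hn Z).2 _).2 ⟨biprod.inr ≫ k, by simp⟩,
        map_zero, map_zero, add_zero]

instance isFP_isClosedUnderBinaryProducts [HasBinaryBiproducts C] :
    (IsFP C).IsClosedUnderBinaryProducts where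
  limitsOfShape_le := by
    rintro M ⟨p⟩
    exact (IsFP C).prop_of_iso
      (IsLimit.conePointsIsoOfNatIso (BinaryBiproduct.isLimit _ _) p.isLimit
        (diagramIsoPair p.diag).symm)
      (isFP_biprod (p.prop_diag_obj ⟨WalkingPair.left⟩) (p.prop_diag_obj ⟨WalkingPair.right⟩))

instance isFP_isClosedUnderFiniteProducts [HasBinaryBiproducts C] [HasZeroObject C] :
    (IsFP C).IsClosedUnderFiniteProducts := .mk'

end FinitelyPresented

end DualizingVariety

end

noncomputable section

namespace DualizingVariety

/-! ### The adjunction `P ⊗_{R_P} - ⊣ Hom(P, -)` -/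

section TensorHomP

variable {C : Type u} [Category.{u} C] [Preadditive C] {P : ModC C}

/-- Additive maps out of `P(X) ⊗_{R_P} N` from balanced biadditive maps. -/
def tensorPLift {X : C} {N : ModuleCat.{u} (RP P)} {G : Type u} [AddCommGroup G]
    (φ : P.obj.obj X →+ N →+ G)
    (h : ∀ (e : End P) (p : P.obj.obj X) (n : N),
      φ ((e : P ⟶ P).hom.app X p) n = φ p (MulOpposite.op e • n)) : TensorP P X N →+ G :=
  QuotientAddGroup.lift _
    (TensorProduct.liftAddHom φ fun r p n => by
      rw [map_zsmul, AddMonoidHom.zsmul_apply, map_zsmul]) (by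
    rw [tensorPRel, AddSubgroup.closure_le]
    rintro _ ⟨e, p, n, rfl⟩
    rw [SetLike.mem_coe, AddMonoidHom.mem_ker, map_sub, TensorProduct.liftAddHom_tmul,
      TensorProduct.liftAddHom_tmul, h, sub_self])

/-- The image of `p ⊗ n` in `(P ⊗_{R_P} N)(X)`. -/
def tmk {X : C} {N : ModuleCat.{u} (RP P)} (p : P.obj.obj X) (n : N) :
    ((tensorP P).obj N).obj.obj X :=
  (QuotientAddGroup.mk (p ⊗ₜ[ℤ] n) : TensorP P X N)

theorem tmk_add_left {X : C} {N : ModuleCat.{u} (RP P)} (p p' : P.obj.obj X) (n : N) :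
    tmk (p + p') n = tmk p n + tmk p' n :=
  congrArg (QuotientAddGroup.mk (s := tensorPRel P X N)) (TensorProduct.add_tmul p p' n)

theorem tmk_add_right {X : C} {N : ModuleCat.{u} (RP P)} (p : P.obj.obj X) (n n' : N) :
    tmk p (n + n') = tmk p n + tmk p n' :=
  congrArg (QuotientAddGroup.mk (s := tensorPRel P X N)) (TensorProduct.tmul_add p n n')

theorem tmk_balanced {X : C} {N : ModuleCat.{u} (RP P)} (e : End P) (p : P.obj.obj X) (n : N) :
    tmk ((e : P ⟶ P).hom.app X p) n = tmk p (MulOpposite.op e • n) :=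
  QuotientAddGroup.eq_iff_sub_mem.2 (AddSubgroup.subset_closure ⟨e, p, n, rfl⟩)

theorem map_tmk {X Y : C} {N : ModuleCat.{u} (RP P)} (f : X ⟶ Y) (p : P.obj.obj X) (n : N) :
    ((tensorP P).obj N).obj.map f (tmk p n) = tmk (P.obj.map f p) n :=
  tensorPMap_mk f (𝟙 N) p n

theorem tensorP_map_tmk {X : C} {N N' : ModuleCat.{u} (RP P)} (β : N ⟶ N') (p : P.obj.obj X)
    (n : N) : ((tensorP P).map β).hom.app X (tmk p n) = tmk p (β.hom n) :=
  (tensorPMap_mk (𝟙 X) β p n).trans (congrArg (fun q => tmk q (β.hom n)) (map_id_apply P p))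

theorem tensorP_obj_hom_ext {N : ModuleCat.{u} (RP P)} {M : ModC C}
    {α β : (tensorP P).obj N ⟶ M}
    (h : ∀ (X : C) (p : P.obj.obj X) (n : N), α.hom.app X (tmk p n) = β.hom.app X (tmk p n)) :
    α = β :=
  ObjectProperty.hom_ext _ <| NatTrans.ext <| funext fun X =>
    AddCommGrpCat.hom_ext <| tensorP_hom_ext <| h X

/-- The map `N ⟶ Hom(P, M)` adjoint to `P ⊗_{R_P} N ⟶ M`. -/
def tensorPCurry {N : ModuleCat.{u} (RP P)} {M : ModC C} (α : (tensorP P).obj N ⟶ M) :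
    N ⟶ (homP P).obj M :=
  ModuleCat.ofHom
    { toFun := fun n => show P ⟶ M from modHomMk
        (fun X =>
          { toFun := fun p => α.hom.app X (tmk p n)
            map_zero' := by
              have := tmk_add_left (0 : P.obj.obj X) 0 n
              rw [add_zero, left_eq_add] at this
              rw [this, map_zero]
            map_add' := fun p p' => by rw [tmk_add_left, map_add] })
        (fun f p => by
          change α.hom.app _ (tmk (P.obj.map f p) n) = M.obj.map f (α.hom.app _ (tmk p n))
          rw [← naturality_apply, map_tmk])
      map_add' := fun n n' => mod_hom_ext fun X p => by
        change α.hom.app X (tmk p (n + n')) = α.hom.app X (tmk p n) + α.hom.app X (tmk p n')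
        rw [tmk_add_right, map_add]
      map_smul' := fun e n => mod_hom_ext fun X p => by
        change α.hom.app X (tmk p (e • n)) = α.hom.app X (tmk (e.unop.hom.app X p) n)
        rw [tmk_balanced, MulOpposite.op_unop] }

/-- The biadditive map `P(X) × N ⟶ M(X)` given by `N ⟶ Hom(P, M)`. -/
def homPEval {N : ModuleCat.{u} (RP P)} {M : ModC C} (β : N ⟶ (homP P).obj M) (X : C) :
    P.obj.obj X →+ N →+ M.obj.obj X :=
  AddMonoidHom.mk' (fun p =>
      AddMonoidHom.mk' (fun n => (show P ⟶ M from β.hom n).hom.app X p) fun n n' => by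
        rw [map_add]
        rfl)
    fun p p' => AddMonoidHom.ext fun n => map_add ((show P ⟶ M from β.hom n).hom.app X).hom p p'

theorem homPEval_apply {N : ModuleCat.{u} (RP P)} {M : ModC C} (β : N ⟶ (homP P).obj M) (X : C)
    (p : P.obj.obj X) (n : N) : homPEval β X p n = (show P ⟶ M from β.hom n).hom.app X p := rfl

/-- The map `P ⊗_{R_P} N ⟶ M` adjoint to `N ⟶ Hom(P, M)`. -/
def tensorPUncurry {N : ModuleCat.{u} (RP P)} {M : ModC C} (β : N ⟶ (homP P).obj M) :
    (tensorP P).obj N ⟶ M :=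
  ObjectProperty.homMk
    { app := fun X => AddCommGrpCat.ofHom (tensorPLift (homPEval β X) fun e p n => by
        rw [homPEval_apply, homPEval_apply, map_smul]
        rfl)
      naturality := fun X Y f => AddCommGrpCat.hom_ext <| tensorP_hom_ext fun p n =>
        naturality_apply (show P ⟶ M from β.hom n) f p }

theorem tensorPUncurry_tmk {N : ModuleCat.{u} (RP P)} {M : ModC C} (β : N ⟶ (homP P).obj M)
    {X : C} (p : P.obj.obj X) (n : N) :
    (tensorPUncurry β).hom.app X (tmk p n) = (show P ⟶ M from β.hom n).hom.app X p := rfl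

variable (P) in
/-- The adjunction between `P ⊗_{R_P} -` and `Hom(P, -)`. -/
def tensorPAdj : tensorP P ⊣ homP P :=
  Adjunction.mkOfHomEquiv
    { homEquiv := fun N M =>
        { toFun := tensorPCurry
          invFun := tensorPUncurry
          left_inv := fun α => tensorP_obj_hom_ext fun X p n => rfl
          right_inv := fun β => rfl }
      homEquiv_naturality_left_symm := fun {N N' M} f g =>
        tensorP_obj_hom_ext fun X p n => by
          refine (tensorPUncurry_tmk (f ≫ g) p n).trans (Eq.symm ?_)
          exact (congrArg ((tensorPUncurry g).hom.app X) (tensorP_map_tmk f p n)).trans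
            (tensorPUncurry_tmk g p (f.hom n))
      homEquiv_naturality_right := fun {N M M'} f g => rfl }

end TensorHomP

/-! ### The case of a representable `P`: the unit of `P ⊗_{R_P} - ⊣ Hom(P, -)` is invertible -/

section HomRep

variable {C : Type u} [Category.{u} C] [Preadditive C]

variable (c : C)

/-- The action map `P(c) ⊗_{R_P} N ⟶ N`, for `P = Hom_C(c, -)`. -/
def tensorRepEval (N : ModuleCat.{u} (RP (rep c))) : TensorP (rep c) c N →+ N :=
  tensorPLift
    (AddMonoidHom.mk' (fun p => AddMonoidHom.mk'
        (fun n => (MulOpposite.op (repHom p : End (rep c)) : RP (rep c)) • n)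
        fun n n' => smul_add _ n n')
      fun p p' => AddMonoidHom.ext fun n => by
        change (MulOpposite.op (repHom (p + p') : End (rep c)) : RP (rep c)) • n =
          (MulOpposite.op (repHom p : End (rep c)) : RP (rep c)) • n +
          (MulOpposite.op (repHom p' : End (rep c)) : RP (rep c)) • n
        rw [← add_smul]
        exact congrArg (fun e : End (rep c) => (MulOpposite.op e : RP (rep c)) • n)
          ((repEquiv c (rep c)).symm.map_add p p'))
    fun e p n => by
      change (MulOpposite.op (repHom _ : End (rep c)) : RP (rep c)) • n =
          (MulOpposite.op (repHom p : End (rep c)) : RP (rep c)) • (MulOpposite.op e : RP (rep c)) • n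
      rw [smul_smul]
      exact congrArg (fun e : End (rep c) => (MulOpposite.op e : RP (rep c)) • n)
        (repHom_comp p e).symm

theorem tensorRepEval_mk (N : ModuleCat.{u} (RP (rep c))) (p : (rep c).obj.obj c) (n : N) :
    tensorRepEval c N (tmk p n) =
      (MulOpposite.op (repHom p : End (rep c)) : RP (rep c)) • n := rfl

theorem repHom_id : repHom (M := rep c) (𝟙 c) = 𝟙 (rep c) := rep_hom_ext (repHom_app_id _)

theorem tensorRepEval_one_tmul (N : ModuleCat.{u} (RP (rep c))) (n : N) :
    tensorRepEval c N (tmk (P := rep c) (𝟙 c) n) = n :=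
  (congrArg (fun e : End (rep c) => (MulOpposite.op e : RP (rep c)) • n) (repHom_id c)).trans
    (one_smul (RP (rep c)) n)

theorem one_tmul_tensorRepEval (N : ModuleCat.{u} (RP (rep c))) (t : TensorP (rep c) c N) :
    tmk (P := rep c) (𝟙 c) (tensorRepEval c N t) = t := by
  refine DFunLike.congr_fun (F := TensorP (rep c) c N →+ TensorP (rep c) c N)
    (f := AddMonoidHom.mk' (fun t => tmk (P := rep c) (𝟙 c) (tensorRepEval c N t)) fun t t' => by
      rw [map_add]
      exact tmk_add_right _ _ _) (g := AddMonoidHom.id _) (tensorP_hom_ext fun p n => ?_) t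
  change tmk (P := rep c) (𝟙 c) (tensorRepEval c N (tmk p n)) = tmk p n
  rw [tensorRepEval_mk]
  -- `p` is the value at `1_c` of the endomorphism `repHom p`, so `p ⊗ n = 1 ⊗ p·n`.
  exact (tmk_balanced (repHom p : End (rep c)) _ n).symm.trans
    (congrArg (fun q => tmk (P := rep c) q n) (repHom_app_id p))

/-- By Yoneda `Hom(P, P ⊗ N)` is `P(c) ⊗ N`. The unit becomes `n ↦ 1 ⊗ n`, whose inverse is the
action map `tensorRepEval`. -/
theorem isIso_tensorPAdj_unit_app (N : ModuleCat.{u} (RP (rep c))) :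
    IsIso ((tensorPAdj (rep c)).unit.app N) := by
  refine (ConcreteCategory.isIso_iff_bijective _).2 ⟨fun n n' h => ?_, fun α => ?_⟩
  · have := congrArg (fun k : rep c ⟶ (tensorP (rep c)).obj N => k.hom.app c (𝟙 c)) h
    rw [← tensorRepEval_one_tmul c N n, ← tensorRepEval_one_tmul c N n']
    exact congrArg (tensorRepEval c N) this
  · let α' : rep c ⟶ (tensorP (rep c)).obj N := α
    exact ⟨tensorRepEval c N (α'.hom.app c (𝟙 c)),
      rep_hom_ext (M := (tensorP (rep c)).obj N) (one_tmul_tensorRepEval c N (α'.hom.app c (𝟙 c)))⟩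

instance isIso_tensorPAdj_unit : IsIso (tensorPAdj (rep c)).unit := by
  have := isIso_tensorPAdj_unit_app c
  exact NatIso.isIso_of_isIso_app _

/-! ### The adjunction `Hom(P, -) ⊣ Hom_{R_P}(P^*, -)` -/

theorem repHom_map {M : ModC C} {X Y : C} (f : X ⟶ Y) (m : M.obj.obj X) :
    repHom (M.obj.map f m) = (repFunctor C).map f.op ≫ repHom m :=
  rep_hom_ext ((repHom_app_id _).trans
    (congrArg (fun g => M.obj.map g m) (Category.comp_id f).symm))

theorem repFunctor_map_app_id {X Y : C} (f : rep X ⟶ rep Y) :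
    (repFunctor C).map (Quiver.Hom.op (show Y ⟶ X from f.hom.app X (𝟙 X))) = f :=
  rep_hom_ext (Category.comp_id (X := Y) (Y := X) _)

theorem repHom_add {M : ModC C} {X : C} (m m' : M.obj.obj X) :
    repHom (m + m') = repHom m + repHom m' := (repEquiv X M).symm.map_add m m'

/-- An element of `Hom_{R_P}(P^*, N)(X)` as an `R_P`-linear map on `P^*(X)`. -/
abbrev homPStarHom {c X : C} {N : ModuleCat.{u} (RP (rep c))}
    (k : ((homPStar (rep c)).obj N).obj.obj X) : (homP (rep c)).obj (rep X) ⟶ N := k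

/-- The adjunct `M ⟶ Hom_{R_P}(P^*, N)` of `Hom(P, M) ⟶ N`. -/
def homPCurry {M : ModC C} {N : ModuleCat.{u} (RP (rep c))} (α : (homP (rep c)).obj M ⟶ N) :
    M ⟶ (homPStar (rep c)).obj N :=
  modHomMk
    (fun X => AddMonoidHom.mk' (fun m => show (homP (rep c)).obj (rep X) ⟶ N from
        (homP (rep c)).map (repHom m) ≫ α) fun m m' => by
      rw [repHom_add, Functor.map_add, Preadditive.add_comp]
      rfl)
    (fun f m => by
      change (homP (rep c)).map (repHom _) ≫ α =
        (homP (rep c)).map ((repFunctor C).map f.op) ≫ (homP (rep c)).map (repHom m) ≫ α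
      rw [repHom_map, Functor.map_comp, Category.assoc])

/-- The adjunct `Hom(P, M) ⟶ N` of `M ⟶ Hom_{R_P}(P^*, N)`. -/
def homPUncurry {M : ModC C} {N : ModuleCat.{u} (RP (rep c))}
    (β : M ⟶ (homPStar (rep c)).obj N) : (homP (rep c)).obj M ⟶ N :=
  ModuleCat.ofHom
    { toFun := fun m : rep c ⟶ M =>
        (homPStarHom (β.hom.app c (m.hom.app c (𝟙 c)))).hom (𝟙 (rep c))
      map_add' := fun m m' : rep c ⟶ M => by
        change (homPStarHom (β.hom.app c (m.hom.app c (𝟙 c) + m'.hom.app c (𝟙 c)))).hom _ = _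
        rw [map_add]
        rfl
      map_smul' := fun e (m : rep c ⟶ M) => by
        -- The scalar `e` is precomposition with the endomorphism of `P` induced by `g`. It replaces
        -- `m(1)` by `g·m(1)`; naturality of `β` moves `g` into the argument, where it turns `1`
        -- into `e • 1`, and linearity of `k` brings `e` out.
        let g : c ⟶ c := e.unop.hom.app c (𝟙 c)
        have h : (e • 𝟙 (rep c) : (homP (rep c)).obj (rep c)) =
            (𝟙 (rep c) ≫ (repFunctor C).map g.op : rep c ⟶ rep c) := by
          rw [repFunctor_map_app_id]
          rfl
        let k := homPStarHom (β.hom.app c (m.hom.app c (𝟙 c)))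
        have h₁ := congrArg (fun x => (homPStarHom (β.hom.app c x)).hom (𝟙 (rep c)))
          (rep_hom_app m g)
        have h₂ := congrArg (fun y => (homPStarHom y).hom (𝟙 (rep c)))
          (naturality_apply β g (m.hom.app c (𝟙 c)))
        exact h₁.trans (h₂.trans ((congrArg k.hom h.symm).trans
          (map_smul k.hom e (show (homP (rep c)).obj (rep c) from 𝟙 (rep c))))) }

/-- The adjunction between `Hom(P, -)` and `Hom_{R_P}(P^*, -)`, for `P = Hom_C(c, -)`. -/
def homPAdj : homP (rep c) ⊣ homPStar (rep c) :=
  Adjunction.mkOfHomEquiv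
    { homEquiv := fun M N =>
        { toFun := homPCurry c
          invFun := homPUncurry c
          left_inv := fun α => ModuleCat.hom_ext <| LinearMap.ext fun m : rep c ⟶ M => by
            refine congrArg α.hom (?_ : 𝟙 (rep c) ≫ repHom _ = m)
            rw [Category.id_comp]
            exact rep_hom_ext (repHom_app_id _)
          -- Every element `k` of `P^*(X)` is induced by some `g : X ⟶ c`, so naturality gives
          -- `β(m)(k) = β(g·m)(1)`: all of `β` is recovered from its values at `c` and `1`.
          right_inv := fun β => mod_hom_ext fun X m =>
              ModuleCat.hom_ext <| LinearMap.ext fun k : rep c ⟶ rep X => by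
            let g : X ⟶ c := k.hom.app c (𝟙 c)
            change (homPStarHom (β.hom.app c (M.obj.map g m))).hom (𝟙 (rep c)) =
              (homPStarHom (β.hom.app X m)).hom k
            rw [naturality_apply]
            exact congrArg (homPStarHom (β.hom.app X m)).hom (repFunctor_map_app_id k) }
      homEquiv_naturality_left_symm := fun f g => rfl
      homEquiv_naturality_right := fun f g => rfl }

end HomRep

end DualizingVariety

end

noncomputable section

namespace DualizingVariety

/-! ### The adjunction `C/I ⊗_C - ⊣ π_*` -/

section QuotTensor

variable {C : Type u} [Category.{u} C] [Preadditive C]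

open Classical in
/-- Additive maps out of `A ⊗_C M` from balanced families of biadditive maps. -/
def tensorLift {A : ModC Cᵒᵖ} {M : ModC C} {G : Type u} [AddCommGroup G]
    (φ : ∀ Z : C, A.obj.obj (op Z) →+ M.obj.obj Z →+ G)
    (h : ∀ {Z Z' : C} (f : Z ⟶ Z') (a : A.obj.obj (op Z')) (m : M.obj.obj Z),
      φ Z (A.obj.map f.op a) m = φ Z' a (M.obj.map f m)) : Tensor A M →+ G :=
  QuotientAddGroup.lift _
    (DirectSum.toAddMonoid fun Z => TensorProduct.liftAddHom (φ Z) fun r a m => by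
      rw [map_zsmul, AddMonoidHom.zsmul_apply, map_zsmul]) (by
    rw [tensorRel, AddSubgroup.closure_le]
    rintro _ ⟨X, Y, f, a, m, rfl⟩
    rw [SetLike.mem_coe, AddMonoidHom.mem_ker, map_sub, DirectSum.toAddMonoid_of,
      DirectSum.toAddMonoid_of, TensorProduct.liftAddHom_tmul, TensorProduct.liftAddHom_tmul, h,
      sub_self])

open Classical in
theorem tensorLift_mk {A : ModC Cᵒᵖ} {M : ModC C} {G : Type u} [AddCommGroup G]
    (φ : ∀ Z : C, A.obj.obj (op Z) →+ M.obj.obj Z →+ G)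
    (h : ∀ {Z Z' : C} (f : Z ⟶ Z') (a : A.obj.obj (op Z')) (m : M.obj.obj Z),
      φ Z (A.obj.map f.op a) m = φ Z' a (M.obj.map f m))
    (Z : C) (a : A.obj.obj (op Z)) (m : M.obj.obj Z) :
    tensorLift φ h (QuotientAddGroup.mk
      (DirectSum.of (fun X : C => A.obj.obj (op X) ⊗[ℤ] M.obj.obj X) Z (a ⊗ₜ[ℤ] m))) = φ Z a m := by
  refine (DirectSum.toAddMonoid_of (fun Z => TensorProduct.liftAddHom (φ Z) fun r a m => by
    rw [map_zsmul, AddMonoidHom.zsmul_apply, map_zsmul]) Z (a ⊗ₜ[ℤ] m)).trans ?_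
  rw [TensorProduct.liftAddHom_tmul]

variable {I : CatIdeal C}

open Classical in
/-- The element `a ⊗ m` of `(C/I ⊗_C M)(X)`. -/
def qmk {M : ModC C} {X : I.Quot} {Z : C} (a : I.proj.obj Z ⟶ X) (m : M.obj.obj Z) :
    (I.quotTensor.obj M).obj.obj X :=
  (QuotientAddGroup.mk (DirectSum.of
    (fun Z : C => (I.leftQuot.obj X).obj.obj (op Z) ⊗[ℤ] M.obj.obj Z) Z
      ((show (I.leftQuot.obj X).obj.obj (op Z) from a) ⊗ₜ[ℤ] m)) : Tensor (I.leftQuot.obj X) M)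

theorem qmk_add_right {M : ModC C} {X : I.Quot} {Z : C} (a : I.proj.obj Z ⟶ X)
    (m m' : M.obj.obj Z) : qmk a (m + m') = qmk a m + qmk a m' := by
  classical
  refine congrArg (QuotientAddGroup.mk (s := tensorRel (I.leftQuot.obj X) M)) ?_
  rw [TensorProduct.tmul_add, map_add]

theorem qmk_balanced {M : ModC C} {X : I.Quot} {Z Z' : C} (f : Z ⟶ Z')
    (a : I.proj.obj Z' ⟶ X) (m : M.obj.obj Z) :
    qmk (I.proj.map f ≫ a) m = qmk a (M.obj.map f m) :=
  QuotientAddGroup.eq_iff_sub_mem.2 (AddSubgroup.subset_closure ⟨Z, Z', f, a, m, rfl⟩)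

theorem map_qmk {M : ModC C} {X Y : I.Quot} {Z : C} (g : X ⟶ Y) (a : I.proj.obj Z ⟶ X)
    (m : M.obj.obj Z) : (I.quotTensor.obj M).obj.map g (qmk a m) = qmk (a ≫ g) m :=
  tensorMap_mk (I.leftQuot.map g) (𝟙 M) Z a m

theorem quotTensor_map_qmk {M M' : ModC C} (β : M ⟶ M') {X : I.Quot} {Z : C}
    (a : I.proj.obj Z ⟶ X) (m : M.obj.obj Z) :
    (I.quotTensor.map β).hom.app X (qmk a m) = qmk a (β.hom.app Z m) :=
  tensorMap_mk (𝟙 (I.leftQuot.obj X)) β Z a m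

theorem quotTensor_obj_hom_ext {M : ModC C} {F : ModC I.Quot} {α β : I.quotTensor.obj M ⟶ F}
    (h : ∀ (X : I.Quot) (Z : C) (a : I.proj.obj Z ⟶ X) (m : M.obj.obj Z),
      α.hom.app X (qmk a m) = β.hom.app X (qmk a m)) : α = β :=
  ObjectProperty.hom_ext _ <| NatTrans.ext <| funext fun X =>
    AddCommGrpCat.hom_ext <| tensor_hom_ext <| h X

/-- The adjunct `M ⟶ π_* F` of `C/I ⊗_C M ⟶ F`. -/
def quotTensorCurry {M : ModC C} {F : ModC I.Quot} (α : I.quotTensor.obj M ⟶ F) :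
    M ⟶ I.piStar.obj F :=
  modHomMk
    (fun Z => AddMonoidHom.mk' (fun m => α.hom.app (I.proj.obj Z) (qmk (𝟙 _) m))
      fun m m' => by
        rw [qmk_add_right, map_add]
        rfl)
    (fun {Z Z'} f m => by
      change α.hom.app (I.proj.obj Z') (qmk (𝟙 _) (M.obj.map f m)) =
        F.obj.map (I.proj.map f) (α.hom.app (I.proj.obj Z) (qmk (𝟙 _) m))
      rw [← naturality_apply, map_qmk, ← qmk_balanced, Category.comp_id, Category.id_comp])

/-- The biadditive maps `Hom(πZ, X) × M(Z) ⟶ F(X)` given by `M ⟶ π_* F`. -/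
def quotEval {M : ModC C} {F : ModC I.Quot} (β : M ⟶ I.piStar.obj F) (X : I.Quot) (Z : C) :
    (I.leftQuot.obj X).obj.obj (op Z) →+ M.obj.obj Z →+ F.obj.obj X :=
  AddMonoidHom.mk' (fun a : I.proj.obj Z ⟶ X =>
      (F.obj.map a).hom.comp (β.hom.app Z).hom)
    fun _ _ => AddMonoidHom.ext fun m => map_add_apply F _ _ (β.hom.app Z m)

theorem quotEval_balanced {M : ModC C} {F : ModC I.Quot} (β : M ⟶ I.piStar.obj F) (X : I.Quot)
    {Z Z' : C} (f : Z ⟶ Z') (a : (I.leftQuot.obj X).obj.obj (op Z')) (m : M.obj.obj Z) :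
    quotEval β X Z ((I.leftQuot.obj X).obj.map f.op a) m = quotEval β X Z' a (M.obj.map f m) :=
  (map_comp_apply F (I.proj.map f) (show I.proj.obj Z' ⟶ X from a) (β.hom.app Z m)).trans
    (congrArg (F.obj.map (show I.proj.obj Z' ⟶ X from a)) (naturality_apply β f m).symm)

/-- The value at `X` of the adjunct `C/I ⊗_C M ⟶ F` of `M ⟶ π_* F`. -/
def quotTensorUncurryApp {M : ModC C} {F : ModC I.Quot} (β : M ⟶ I.piStar.obj F) (X : I.Quot) :
    (I.quotTensor.obj M).obj.obj X →+ F.obj.obj X :=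
  tensorLift (quotEval β X) (quotEval_balanced β X)

theorem quotTensorUncurryApp_qmk {M : ModC C} {F : ModC I.Quot} (β : M ⟶ I.piStar.obj F)
    {X : I.Quot} {Z : C} (a : I.proj.obj Z ⟶ X) (m : M.obj.obj Z) :
    quotTensorUncurryApp β X (qmk a m) = F.obj.map a (β.hom.app Z m) :=
  tensorLift_mk (quotEval β X) (quotEval_balanced β X) Z a m

/-- The adjunct `C/I ⊗_C M ⟶ F` of `M ⟶ π_* F`. -/
def quotTensorUncurry {M : ModC C} {F : ModC I.Quot} (β : M ⟶ I.piStar.obj F) :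
    I.quotTensor.obj M ⟶ F :=
  ObjectProperty.homMk
    { app := fun X => AddCommGrpCat.ofHom (quotTensorUncurryApp β X)
      naturality := fun X Y g => AddCommGrpCat.hom_ext <| tensor_hom_ext fun Z a m => by
        let a' : I.proj.obj Z ⟶ X := a
        change quotTensorUncurryApp β Y ((I.quotTensor.obj M).obj.map g (qmk a' m)) =
          F.obj.map g (quotTensorUncurryApp β X (qmk a' m))
        rw [map_qmk, quotTensorUncurryApp_qmk, quotTensorUncurryApp_qmk]
        exact map_comp_apply F a' g (β.hom.app Z m) }

theorem quotTensorUncurry_qmk {M : ModC C} {F : ModC I.Quot} (β : M ⟶ I.piStar.obj F)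
    {X : I.Quot} {Z : C} (a : I.proj.obj Z ⟶ X) (m : M.obj.obj Z) :
    (quotTensorUncurry β).hom.app X (qmk a m) = F.obj.map a (β.hom.app Z m) :=
  quotTensorUncurryApp_qmk β a m

variable (I) in
/-- The adjunction between `C/I ⊗_C -` and `π_*`. -/
def quotTensorAdj : I.quotTensor ⊣ I.piStar :=
  Adjunction.mkOfHomEquiv
    { homEquiv := fun M F =>
        { toFun := quotTensorCurry
          invFun := quotTensorUncurry
          left_inv := fun α => quotTensor_obj_hom_ext fun X Z a m => by
            refine (quotTensorUncurry_qmk _ a m).trans ?_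
            change F.obj.map a (α.hom.app _ (qmk (𝟙 _) m)) = _
            rw [← naturality_apply, map_qmk, Category.id_comp]
          right_inv := fun β => mod_hom_ext fun Z m =>
            (quotTensorUncurry_qmk β _ m).trans (map_id_apply F _) }
      homEquiv_naturality_left_symm := fun {M M' F} f g =>
        quotTensor_obj_hom_ext fun X Z a m => by
          refine (quotTensorUncurry_qmk (f ≫ g) a m).trans (Eq.symm ?_)
          exact (congrArg ((quotTensorUncurry g).hom.app X) (quotTensor_map_qmk f a m)).trans
            (quotTensorUncurry_qmk g a (f.hom.app Z m))
      homEquiv_naturality_right := fun f g => rfl }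

/-! ### The adjunction `π_* ⊣ C(C/I, -)` -/

/-- An element of `C(C/I, M)(X)` as a morphism of `C`-modules. -/
abbrev quotHomHom {X : I.Quot} {M : ModC C} (k : (I.quotHom.obj M).obj.obj X) :
    I.piStar.obj (rep X) ⟶ M := k

/-- The adjunct `F ⟶ C(C/I, M)` of `π_* F ⟶ M`. -/
def quotHomCurry {F : ModC I.Quot} {M : ModC C} (α : I.piStar.obj F ⟶ M) :
    F ⟶ I.quotHom.obj M :=
  modHomMk
    (fun X => AddMonoidHom.mk' (fun x => show I.piStar.obj (rep X) ⟶ M from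
        I.piStar.map (repHom x) ≫ α) fun x x' => by
      rw [repHom_add, Functor.map_add, Preadditive.add_comp]
      rfl)
    (fun f m => by
      change I.piStar.map (repHom _) ≫ α =
        I.piStar.map ((repFunctor I.Quot).map f.op) ≫ I.piStar.map (repHom m) ≫ α
      rw [repHom_map, Functor.map_comp, Category.assoc])

/-- The adjunct `π_* F ⟶ M` of `F ⟶ C(C/I, M)`. -/
def quotHomUncurry {F : ModC I.Quot} {M : ModC C} (β : F ⟶ I.quotHom.obj M) :
    I.piStar.obj F ⟶ M :=
  modHomMk
    (fun Z => AddMonoidHom.mk' (fun x : F.obj.obj (I.proj.obj Z) =>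
        (quotHomHom (β.hom.app (I.proj.obj Z) x)).hom.app Z (𝟙 (I.proj.obj Z)))
      fun x x' => congrArg (fun y => (quotHomHom y).hom.app Z (𝟙 (I.proj.obj Z)))
        (map_add (β.hom.app (I.proj.obj Z)).hom x x'))
    (fun {Z Z'} f x => by
      let k := quotHomHom (β.hom.app (I.proj.obj Z) x)
      have h := congrArg
        (fun y : (I.quotHom.obj M).obj.obj (I.proj.obj Z') =>
          (quotHomHom y).hom.app Z' (𝟙 (I.proj.obj Z')))
        (naturality_apply β (I.proj.map f) x)
      refine h.trans ?_
      -- Naturality of `β` precomposes the argument of `k` with `π f`, naturality of `k`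
      -- postcomposes it; on identities the two agree.
      have e : I.proj.map f ≫ 𝟙 (I.proj.obj Z') = 𝟙 (I.proj.obj Z) ≫ I.proj.map f := by simp
      exact (congrArg (k.hom.app Z') e).trans (naturality_apply k f
        (show (I.piStar.obj (rep (I.proj.obj Z))).obj.obj Z from 𝟙 (I.proj.obj Z))))

variable (I) in
/-- The adjunction between `π_*` and `C(C/I, -)`. -/
def quotHomAdj : I.piStar ⊣ I.quotHom :=
  Adjunction.mkOfHomEquiv
    { homEquiv := fun F M =>
        { toFun := quotHomCurry
          invFun := quotHomUncurry
          left_inv := fun α => mod_hom_ext fun Z x => by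
            exact congrArg (α.hom.app Z) (map_id_apply F x)
          right_inv := fun β => mod_hom_ext fun X x => mod_hom_ext (M := I.piStar.obj (rep X))
              fun Z (g : X ⟶ I.proj.obj Z) => by
            have h := congrArg
              (fun y : (I.quotHom.obj M).obj.obj (I.proj.obj Z) =>
                (quotHomHom y).hom.app Z (𝟙 (I.proj.obj Z))) (naturality_apply β g x)
            exact h.trans (congrArg ((quotHomHom (β.hom.app X x)).hom.app Z)
              (Category.comp_id g)) }
      homEquiv_naturality_left_symm := fun f g => rfl
      homEquiv_naturality_right := fun f g => rfl }

/-- Every morphism and every object of `C/I` comes from `C`, so naturality over `C` is already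
naturality over `C/I`. -/
instance piStar_full : I.piStar.Full where
  map_surjective α :=
    ⟨ObjectProperty.homMk (CategoryTheory.Quotient.natTransLift _ α.hom), rfl⟩

instance piStar_faithful : I.piStar.Faithful where
  map_injective {F G _ _} h := mod_hom_ext fun X x =>
    congrArg (fun k : I.piStar.obj F ⟶ I.piStar.obj G => k.hom.app X.as x) h

variable (I) in
/-- `C/I ⊗_C Hom_C(X, -) ≅ Hom_{C/I}(X, -)`. -/
def quotTensorRepIso (X : C) : I.quotTensor.obj (rep X) ≅ rep (I.proj.obj X) where
  hom := quotTensorUncurry (repHom (M := I.piStar.obj (rep (I.proj.obj X))) (𝟙 (I.proj.obj X)))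
  inv := repHom (M := I.quotTensor.obj (rep X)) (qmk (M := rep X) (𝟙 (I.proj.obj X)) (𝟙 X))
  hom_inv_id := quotTensor_obj_hom_ext fun Y Z a (m : X ⟶ Z) => by
    have h := quotTensorUncurry_qmk
      (repHom (M := I.piStar.obj (rep (I.proj.obj X))) (𝟙 (I.proj.obj X))) a m
    refine (congrArg ((repHom (M := I.quotTensor.obj (rep X))
      (qmk (M := rep X) (𝟙 (I.proj.obj X)) (𝟙 X))).hom.app Y) h).trans ?_
    refine (map_qmk (M := rep X) ((𝟙 _ ≫ I.proj.map m) ≫ a) (𝟙 (I.proj.obj X)) (𝟙 X)).trans ?_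
    rw [Category.id_comp, Category.id_comp]
    exact (qmk_balanced (M := rep X) m a (𝟙 X)).trans
      (congrArg (qmk (M := rep X) a) (Category.id_comp m))
  inv_hom_id := rep_hom_ext <| by
    refine (congrArg ((quotTensorUncurry (repHom (M := I.piStar.obj (rep (I.proj.obj X)))
      (𝟙 (I.proj.obj X)))).hom.app (I.proj.obj X))
      (repHom_app_id (qmk (M := rep X) (𝟙 (I.proj.obj X)) (𝟙 X)))).trans ?_
    refine (quotTensorUncurry_qmk _ _ _).trans ?_
    change (𝟙 (I.proj.obj X) ≫ I.proj.map (𝟙 X)) ≫ 𝟙 (I.proj.obj X) = 𝟙 (I.proj.obj X)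
    simp

end QuotTensor

end DualizingVariety

end

noncomputable section

open ZeroObject

namespace DualizingVariety

attribute [local instance] hasBinaryBiproducts_of_finite_biproducts
  hasZeroObject_of_hasFiniteBiproducts

/-! ### Preservation of finite presentation -/

section Preservation

/-- The dévissage behind all preservation statements for right exact functors: what holds for
representables or free modules passes to their cokernels. -/
theorem isClosedUnderCokernels_inverseImage {A : Type u₁} [Category.{v₁} A] [Preadditive A]
    {B : Type u₂} [Category.{v₂} B] [Preadditive B] (L : A ⥤ B) [L.Additive]
    [PreservesFiniteColimits L] (S : ObjectProperty B) [S.IsClosedUnderCokernels] :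
    (S.inverseImage L).IsClosedUnderCokernels where
  cokernels_le := by
    rintro _ ⟨f, k, hk, hf⟩
    exact S.prop_of_isColimit_cokernelCofork (k.mapIsColimit hk L) hf.1 hf.2

variable {C : Type u} [Category.{u} C] [Preadditive C]

/-- If a right exact functor sends the representable modules to a class of objects which is closed
under cokernels, then it sends the finitely presented modules to that class. -/
theorem prop_of_isFP {A : Type u₁} [Category.{v₁} A] [Preadditive A] (S : ObjectProperty A)
    [S.IsClosedUnderCokernels] [S.IsClosedUnderIsomorphisms] (L : ModC C ⥤ A) [L.Additive]
    [PreservesFiniteColimits L] (h : ∀ X : C, S (L.obj (rep X))) {M : ModC C} (hM : IsFP C M) :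
    S (L.obj M) := by
  obtain ⟨X₀, X₁, f, g, hfg⟩ := hM
  have w : f ≫ g = 0 := mod_hom_ext fun Y m => ((hfg Y).1 _).2 ⟨m, rfl⟩
  have := isIso_cokernel_desc f g w (fun Y => (hfg Y).1) (fun Y => (hfg Y).2)
  have := isClosedUnderCokernels_inverseImage L S
  exact S.prop_of_iso (L.mapIso (asIso (cokernel.desc f g w)))
    ((S.inverseImage L).prop_cokernel f (h X₀) (h X₁))

end Preservation

/-! ### Modules over `C/I` -/

section QuotFP

variable {C : Type u} [Category.{u} C] [Preadditive C] [HasFiniteBiproducts C] (I : CatIdeal C)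

instance quot_hasFiniteBiproducts : HasFiniteBiproducts I.Quot := by
  have := Functor.hasFiniteProducts_of_additive_of_essSurj I.proj
  exact HasFiniteBiproducts.of_hasFiniteProducts

instance quotTensor_additive : I.quotTensor.Additive := (quotTensorAdj I).left_adjoint_additive

instance quotHom_additive : I.quotHom.Additive := (quotHomAdj I).right_adjoint_additive

/-- A left adjoint is right exact, and this one sends representables to representables. -/
theorem isFP_quotTensor {M : ModC C} (hM : IsFP C M) : IsFP I.Quot (I.quotTensor.obj M) := by
  have := (quotTensorAdj I).leftAdjoint_preservesColimits
  exact prop_of_isFP (IsFP I.Quot) I.quotTensor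
    (fun X => (IsFP I.Quot).prop_of_iso (quotTensorRepIso I X).symm (isFP_rep _)) hM

/-- A `C/I`-module is finitely presented if it is finitely presented over `C`. -/
theorem isFP_of_isFP_piStar {F : ModC I.Quot} (hF : IsFP C (I.piStar.obj F)) :
    IsFP I.Quot F := by
  -- `π_*` is fully faithful, so `C/I ⊗_C π_* F ≅ F`.
  exact (IsFP I.Quot).prop_of_iso (asIso ((quotTensorAdj I).counit.app F)) (isFP_quotTensor I hF)

variable {I} in
/-- If the ideal is generated at each object by one morphism, then the finitely presented modules
over `C/I` are finitely presented over `C`. -/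
theorem isFP_piStar (hI : ∀ X : C, ∃ (Z : C) (a : X ⟶ Z), ∀ (Y : C) (f : X ⟶ Y),
    f ∈ I.carrier X Y ↔ ∃ k : Z ⟶ Y, a ≫ k = f) {F : ModC I.Quot} (hF : IsFP I.Quot F) :
    IsFP C (I.piStar.obj F) := by
  have := (quotHomAdj I).leftAdjoint_preservesColimits
  refine prop_of_isFP (IsFP C) I.piStar (fun X => ?_) hF
  obtain ⟨Z, a, ha⟩ := hI X.as
  -- `C(X, -) / I(X, -)` is generated by the class of `1_X`, and its relations `I(X, -)` are the
  -- multiples of `a`.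
  refine (isFP_iff _).2 ⟨X.as, Z, a, 𝟙 X, fun Y => ⟨fun y => ?_, fun g => ?_⟩⟩
  · obtain ⟨g, rfl⟩ := I.proj.map_surjective (show I.proj.obj X.as ⟶ I.proj.obj Y from y)
    exact ⟨g, Category.id_comp (I.proj.map g)⟩
  · rw [← ha]
    change 𝟙 (I.proj.obj X.as) ≫ I.proj.map g = 0 ↔ _
    rw [Category.id_comp, ← I.proj.map_zero, CategoryTheory.Quotient.functor_map_eq_iff]
    change g - 0 ∈ _ ↔ _
    rw [sub_zero]

/-- `π_*` is a right adjoint, hence preserves kernels, and finite presentation is reflected by it.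
-/
theorem isClosedUnderKernels_quot (hI : ∀ F, IsFP I.Quot F → IsFP C (I.piStar.obj F))
    [(IsFP C).IsClosedUnderKernels] : (IsFP I.Quot).IsClosedUnderKernels where
  kernels_le := by
    rintro _ ⟨f, k, hk, hf⟩
    have := (quotTensorAdj I).rightAdjoint_preservesLimits
    exact isFP_of_isFP_piStar I ((IsFP C).prop_of_isLimit_kernelFork (k.mapIsLimit hk I.piStar)
      (hI _ hf.1) (hI _ hf.2))

end QuotFP

/-! ### The ideal of morphisms factoring through `add(c)` -/

section FactorIdeal

variable {C : Type u} [Category.{u} C] [Preadditive C] [HasFiniteBiproducts C]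

theorem addOf_pow (c : C) (n : ℕ) : addOf c (⨁ fun _ : Fin n => c) :=
  ⟨0, n, ⟨biprod.fst, biprod.inl, by ext; simp, by simp⟩⟩

theorem mem_factorIdeal_iff {c X Y : C} (f : X ⟶ Y) : f ∈ (factorIdeal c).carrier X Y ↔
    ∃ (n : ℕ) (a : X ⟶ ⨁ fun _ : Fin n => c) (b : (⨁ fun _ : Fin n => c) ⟶ Y), a ≫ b = f := by
  constructor
  · rintro ⟨Z, a, b, ⟨W, n, ⟨e⟩⟩, rfl⟩
    exact ⟨n, a ≫ biprod.inl ≫ e.hom, e.inv ≫ biprod.fst ≫ b, by simp⟩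
  · rintro ⟨n, a, b, rfl⟩
    exact ⟨_, a, b, addOf_pow c n, rfl⟩

theorem exists_sum_of_mem_factorIdeal {c X Y : C} {f : X ⟶ Y}
    (hf : f ∈ (factorIdeal c).carrier X Y) :
    ∃ (n : ℕ) (a : Fin n → (X ⟶ c)) (b : Fin n → (c ⟶ Y)), f = ∑ i, a i ≫ b i := by
  obtain ⟨n, a, b, rfl⟩ := (mem_factorIdeal_iff f).1 hf
  refine ⟨n, fun i => a ≫ biproduct.π (fun _ : Fin n => c) i,
    fun i => biproduct.ι (fun _ : Fin n => c) i ≫ b, ?_⟩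
  simp only [Category.assoc, ← Preadditive.comp_sum]
  simp only [← Category.assoc, ← Preadditive.sum_comp]
  rw [biproduct.total, Category.comp_id]

/-- By Yoneda a morphism `P ⟶ C(X, -)` is precomposition with some `a : X ⟶ c`, so its image
consists of the morphisms `a ≫ b`. Finite sums of such composites are the morphisms that factor
through some `cⁿ`. -/
theorem factorIdeal_eq_traceIdeal (c : C) : factorIdeal c = traceIdeal (rep c) := by
  refine CatIdeal.ext (funext fun X => funext fun Y => le_antisymm (fun f hf => ?_) ?_)
  · obtain ⟨n, a, b, rfl⟩ := exists_sum_of_mem_factorIdeal hf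
    refine sum_mem fun i _ => ?_
    exact AddSubgroup.mem_iSup_of_mem (repHom (M := rep X) (a i)) ⟨b i, rfl⟩
  · refine iSup_le fun α => ?_
    rintro _ ⟨g, rfl⟩
    let a : X ⟶ c := α.hom.app c (𝟙 c)
    let g' : c ⟶ Y := g
    have e : (α.hom.app Y) g' = (a ≫ g' : X ⟶ Y) := rep_hom_app α g'
    have e' : biproduct.lift (fun _ : Fin 1 => a) ≫ biproduct.desc (fun _ : Fin 1 => g') =
        a ≫ g' := by simp [biproduct.lift_desc]
    exact (mem_factorIdeal_iff _).2 ⟨1, _, _, e'.trans e.symm⟩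

/-- Write `f` as a sum of composites `aᵢ ≫ bᵢ` through `c`; each `aᵢ` already kills `m`. -/
theorem map_eq_zero_of_mem_factorIdeal {c X Y : C} {M : ModC C} {m : M.obj.obj X}
    (hm : ∀ g : X ⟶ c, M.obj.map g m = 0) {f : X ⟶ Y} (hf : f ∈ (factorIdeal c).carrier X Y) :
    M.obj.map f m = 0 := by
  obtain ⟨n, a, b, rfl⟩ := exists_sum_of_mem_factorIdeal hf
  refine (map_sum ((repHom m).hom.app Y).hom _ _).trans (Finset.sum_eq_zero fun i _ => ?_)
  exact (map_comp_apply M (a i) (b i) m).trans (by rw [hm, map_zero])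

/-- `f₁, …, fₙ` generating `Hom_C(X, c)` as an `End(c)`-module give a left
`add(c)`-approximation of `X`. -/
theorem exists_approximation (R : Type u) [CommRing R] [Linear R C] (c X : C)
    [Module.Finite R (X ⟶ c)] : ∃ (Z : C) (a : X ⟶ Z), ∀ (Y : C) (f : X ⟶ Y),
      f ∈ (factorIdeal c).carrier X Y ↔ ∃ k : Z ⟶ Y, a ≫ k = f := by
  obtain ⟨n, s, hs⟩ := Module.Finite.exists_fin (R := R) (M := (X ⟶ c))
  refine ⟨⨁ fun _ : Fin n => c, biproduct.lift s, fun Y f => ⟨fun hf => ?_, ?_⟩⟩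
  · obtain ⟨m, a, b, rfl⟩ := (mem_factorIdeal_iff f).1 hf
    have h : ∀ g : X ⟶ c, ∃ k, biproduct.lift s ≫ k = g := fun g => by
      obtain ⟨r, rfl⟩ := (Submodule.mem_span_range_iff_exists_fun R).1
        (hs ▸ Submodule.mem_top : g ∈ Submodule.span R (Set.range s))
      -- Scalars act through the endomorphisms `r • 1_c`, so generators over `R` are enough.
      exact ⟨biproduct.desc fun i => r i • 𝟙 c, by simp [biproduct.lift_desc]⟩
    choose k hk using fun i => h (a ≫ biproduct.π _ i)
    refine ⟨biproduct.lift k ≫ b, ?_⟩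
    rw [← Category.assoc]
    congr 1
    ext i
    simp [hk]
  · rintro ⟨k, rfl⟩
    exact (mem_factorIdeal_iff _).2 ⟨n, _, k, rfl⟩

end FactorIdeal

/-! ### Modules over `R_P` -/

section ModulesRP

variable {C : Type u} [Category.{u} C] [Preadditive C]

instance isFG_isClosedUnderQuotients (A : Type u) [Ring A] :
    (ModuleCat.isFG.{u} A).IsClosedUnderQuotients where
  prop_of_epi {M N} f _ hM := by
    rw [ModuleCat.isFG_iff] at hM ⊢
    exact Module.Finite.of_surjective f.hom ((ModuleCat.epi_iff_surjective f).1 inferInstance)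

section Finiteness

variable (R : Type u) [CommRing R] [Linear R C] (c : C)

/-- The ring homomorphism `R ⟶ R_P`, for `P = Hom_C(c, -)`. -/
def rpScalar : R →+* RP (rep c) where
  toFun r := MulOpposite.op ((repFunctor C).map (r • 𝟙 c).op : End (rep c))
  map_one' := by
    rw [one_smul, op_id, (repFunctor C).map_id]
    rfl
  map_mul' r s := by
    rw [← MulOpposite.op_mul]
    refine congrArg MulOpposite.op ?_
    change _ = (repFunctor C).map (r • 𝟙 c).op ≫ (repFunctor C).map (s • 𝟙 c).op
    rw [← (repFunctor C).map_comp, ← op_comp]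
    simp [smul_smul]
  map_zero' := by
    rw [zero_smul, op_zero, (repFunctor C).map_zero]
    rfl
  map_add' r s := by
    rw [add_smul, op_add, (repFunctor C).map_add]
    rfl

theorem rpScalar_smul_app {X : C} (r : R) (h : rep c ⟶ rep X) :
    (show rep c ⟶ rep X from (rpScalar R c r • h : (homP (rep c)).obj (rep X))).hom.app c (𝟙 c) =
      (r • (show X ⟶ c from h.hom.app c (𝟙 c)) : X ⟶ c) := by
  have h₁ : (r • 𝟙 c) ≫ 𝟙 c = r • 𝟙 c := Category.comp_id _
  refine (congrArg (h.hom.app c) h₁).trans ((rep_hom_app h (r • 𝟙 c)).trans ?_)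
  exact (Linear.comp_smul X c c (show X ⟶ c from h.hom.app c (𝟙 c)) r (𝟙 c)).trans
    (congrArg (r • ·) (Category.comp_id _))

/-- By Yoneda this module is `C(X, c)`, which is noetherian over `R`. The `R`-action factors through
`rpScalar`, so every `R_P`-submodule is an `R`-submodule. -/
theorem isNoetherian_homP_rep [IsNoetherianRing R] (X : C) [Module.Finite R (X ⟶ c)] :
    IsNoetherian (RP (rep c)) ((homP (rep c)).obj (rep X)) := by
  let : Module R ((homP (rep c)).obj (rep X)) := Module.compHom _ (rpScalar R c)
  let : Module R (RP (rep c)) := Module.compHom _ (rpScalar R c)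
  have : IsScalarTower R (RP (rep c)) ((homP (rep c)).obj (rep X)) :=
    ⟨fun r e h => mul_smul (rpScalar R c r) e h⟩
  let φ : ((homP (rep c)).obj (rep X)) ≃ₗ[R] (X ⟶ c) :=
    { (repEquiv c (rep X) : (rep c ⟶ rep X) ≃+ (X ⟶ c)) with
      map_smul' := fun r h => rpScalar_smul_app R c r h }
  have : IsNoetherian R (X ⟶ c) := inferInstance
  have : IsNoetherian R ((homP (rep c)).obj (rep X)) := isNoetherian_of_linearEquiv φ.symm
  exact isNoetherian_of_tower R inferInstance

/-- `R_P ≅ Hom(P, P)` as `R_P`-modules. -/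
def rpEquiv (P : ModC C) : RP P ≃ₗ[RP P] (homP P).obj P where
  toFun e := (show P ⟶ P from e.unop)
  invFun f := MulOpposite.op (show End P from f)
  map_add' _ _ := rfl
  map_smul' _ _ := rfl
  left_inv _ := rfl
  right_inv _ := rfl

theorem isNoetherianRing_rp [IsNoetherianRing R] [Module.Finite R (c ⟶ c)] :
    IsNoetherianRing (RP (rep c)) := by
  have := isNoetherian_homP_rep R c c
  exact isNoetherian_of_linearEquiv (rpEquiv (rep c)).symm

/-- `Hom(P, -)` has a right adjoint and is therefore right exact, so only the modules `Hom(P, C(X,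
-))` have to be finitely generated. -/
theorem isFG_homP [IsNoetherianRing R] (hR : ∀ X : C, Module.Finite R (X ⟶ c)) {M : ModC C}
    (hM : IsFP C M) : ModuleCat.isFG (RP (rep c)) ((homP (rep c)).obj M) := by
  have := (homPAdj c).leftAdjoint_preservesColimits
  have : PreservesFiniteColimits (homP (rep c)) := PreservesColimits.preservesFiniteColimits _
  refine prop_of_isFP _ (homP (rep c)) (fun X => ?_) hM
  have := isNoetherian_homP_rep R c X
  exact Module.IsNoetherian.finite (RP (rep c)) ((homP (rep c)).obj (rep X))

end Finiteness

variable (c : C)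

/-- `P ⊗_{R_P} R_P ≅ P`, for `P = Hom_C(c, -)`. -/
def tensorPRingIso : (tensorP (rep c)).obj (ModuleCat.of _ (RP (rep c))) ≅ rep c where
  hom := tensorPUncurry (ModuleCat.ofHom (rpEquiv (rep c)).toLinearMap)
  inv := repHom (M := (tensorP (rep c)).obj (ModuleCat.of _ (RP (rep c))))
    (tmk (P := rep c) (N := ModuleCat.of _ (RP (rep c))) (𝟙 c) (1 : RP (rep c)))
  hom_inv_id := tensorP_obj_hom_ext fun X (p : c ⟶ X) (e : RP (rep c)) => by
    let q : c ⟶ X := e.unop.hom.app X p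
    refine (map_tmk (P := rep c) (N := ModuleCat.of _ (RP (rep c))) q (𝟙 c)
      (1 : RP (rep c))).trans ?_
    refine (congrArg (fun p : (rep c).obj.obj X => tmk (P := rep c)
      (N := ModuleCat.of _ (RP (rep c))) p (1 : RP (rep c))) (Category.id_comp q)).trans ?_
    refine (tmk_balanced (P := rep c) (N := ModuleCat.of _ (RP (rep c))) e.unop p
      (1 : RP (rep c))).trans ?_
    exact congrArg (tmk (P := rep c) (N := ModuleCat.of _ (RP (rep c))) p) (mul_one e)
  inv_hom_id := rep_hom_ext (congrArg
    ((tensorPUncurry (ModuleCat.ofHom (rpEquiv (rep c)).toLinearMap)).hom.app c)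
    (repHom_app_id (M := (tensorP (rep c)).obj (ModuleCat.of _ (RP (rep c))))
      (tmk (P := rep c) (N := ModuleCat.of _ (RP (rep c))) (𝟙 c) (1 : RP (rep c)))))

instance tensorP_additive (P : ModC C) : (tensorP P).Additive :=
  (tensorPAdj P).left_adjoint_additive

variable [HasFiniteBiproducts C]

theorem isFP_tensorP_free (n : ℕ) :
    IsFP C ((tensorP (rep c)).obj (ModuleCat.of _ (Fin n → RP (rep c)))) := by
  refine (IsFP C).prop_of_iso ((tensorP (rep c)).mapIso (ModuleCat.biproductIsoPi
    fun _ : Fin n => ModuleCat.of (RP (rep c)) (RP (rep c)))) ?_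
  refine (IsFP C).prop_of_iso ((tensorP (rep c)).mapBiproduct _ ≪≫ biproduct.isoProduct _).symm ?_
  exact (IsFP C).prop_product fun _ =>
    (IsFP C).prop_of_iso (tensorPRingIso c).symm (isFP_rep c)

/-- Over a noetherian ring `N` is the cokernel of a map between finite free modules, and `P ⊗ -`
takes these to finite powers of `P`. -/
theorem isFP_tensorP [IsNoetherianRing (RP (rep c))] {N : ModuleCat.{u} (RP (rep c))}
    (hN : ModuleCat.isFG (RP (rep c)) N) : IsFP C ((tensorP (rep c)).obj N) := by
  rw [ModuleCat.isFG_iff] at hN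
  obtain ⟨m, g, hg⟩ := Module.Finite.exists_fin' (RP (rep c)) N
  obtain ⟨n, f, hf⟩ := Module.Finite.exists_fin' (RP (rep c)) (LinearMap.ker g)
  let S : ShortComplex (ModuleCat.{u} (RP (rep c))) :=
    ShortComplex.mk (ModuleCat.ofHom ((LinearMap.ker g).subtype ∘ₗ f)) (ModuleCat.ofHom g)
      (ModuleCat.hom_ext <| LinearMap.ext fun x => (f x).2)
  have hS : S.Exact := by
    rw [ShortComplex.moduleCat_exact_iff]
    intro x hx
    obtain ⟨y, hy⟩ := hf ⟨x, hx⟩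
    exact ⟨y, congrArg Subtype.val hy⟩
  have : Epi S.g := (ModuleCat.epi_iff_surjective _).2 hg
  have := (tensorPAdj (rep c)).leftAdjoint_preservesColimits
  have := isClosedUnderCokernels_inverseImage (tensorP (rep c)) (IsFP C)
  exact ((IsFP C).inverseImage (tensorP (rep c))).prop_of_isColimit_cokernelCofork hS.gIsCokernel
    (isFP_tensorP_free c n) (isFP_tensorP_free c m)

end ModulesRP

end DualizingVariety

end

noncomputable section

open ZeroObject

namespace DualizingVariety

attribute [local instance] hasBinaryBiproducts_of_finite_biproducts
  hasZeroObject_of_hasFiniteBiproducts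

/-! ### The duality -/

section Duality

variable {C : Type u} [Category.{u} C] [Preadditive C]
  {R : Type u} [CommRing R] [Linear R C] {E : ModuleCat.{u} R}

variable (R C E) in
/-- `M ↦ Hom_R(M(-), E)` restricts to a duality from `mod(C)` to `mod(Cᵒᵖ)`; the conditions are
stated for the functor on `Mod(C)`. -/
structure IsDuality : Prop where
  isFP_dual : ∀ {M : ModC C}, IsFP C M → IsFP Cᵒᵖ ((dual R C E).obj (op M))
  bijective : ∀ {M N : ModC C}, IsFP C M → IsFP C N →
    Function.Bijective (fun f : M ⟶ N => (dual R C E).map f.op)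
  exists_iso : ∀ {T : ModC Cᵒᵖ}, IsFP Cᵒᵖ T →
    ∃ M : ModC C, IsFP C M ∧ Nonempty ((dual R C E).obj (op M) ≅ T)

theorem IsDualizing.exists_isDuality [IsArtinianRing R] [HasFiniteBiproducts C]
    [IsIdempotentComplete C] (hC : IsDualizing R C) :
    ∃ E : ModuleCat.{u} R, IsDuality C R E := by
  obtain ⟨E, _, _, h, _⟩ := hC.duality
  let F : (FPMod C)ᵒᵖ ⥤ FPMod Cᵒᵖ := (IsFP Cᵒᵖ).lift ((IsFP C).ι.op ⋙ dual R C E) h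
  refine ⟨E, fun {M} hM => h (op ⟨M, hM⟩), fun {M N} hM hN => ?_, fun {T} hT => ?_⟩
  · let M' : FPMod C := ⟨M, hM⟩
    let N' : FPMod C := ⟨N, hN⟩
    constructor
    · intro f g hfg
      let f' : M' ⟶ N' := ObjectProperty.homMk f
      let g' : M' ⟶ N' := ObjectProperty.homMk g
      have : f'.op = g'.op := F.map_injective (ObjectProperty.hom_ext _ hfg)
      exact congrArg (fun k : op N' ⟶ op M' => k.unop.hom) this
    · intro α
      obtain ⟨k, hk⟩ := F.map_surjective
        (show F.obj (op N') ⟶ F.obj (op M') from ObjectProperty.homMk α)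
      exact ⟨k.unop.hom, congrArg (fun l : F.obj (op N') ⟶ F.obj (op M') => l.hom) hk⟩
  · let T' : FPMod Cᵒᵖ := ⟨T, hT⟩
    exact ⟨(F.objPreimage T').unop.obj, (F.objPreimage T').unop.property,
      ⟨(IsFP Cᵒᵖ).ι.mapIso (F.objObjPreimageIso T')⟩⟩

theorem dual_map_zero (M N : ModC C) : (dual R C E).map (0 : M ⟶ N).op = 0 := by
  refine mod_hom_ext fun X k => ModuleCat.hom_ext <| LinearMap.ext fun x => ?_
  exact map_zero (show (toModuleR R N).obj X.unop ⟶ E from k).hom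

/-- Over a dualizing variety, the finitely presented modules are closed under kernels. -/
theorem IsDuality.isClosedUnderKernels [HasFiniteBiproducts C] [HasFiniteBiproducts Cᵒᵖ]
    (hD : IsDuality C R E) : (IsFP C).IsClosedUnderKernels where
  kernels_le := by
    rintro _ ⟨f, c, hc, hM, hN⟩
    rename_i M N
    refine (IsFP C).prop_of_iso (limit.isLimit _ |>.conePointUniqueUpToIso hc) ?_
    -- `K` is the candidate for the kernel: the module whose dual is the cokernel of the dual of
    -- `f`.
    obtain ⟨K, hK, ⟨e⟩⟩ := hD.exists_iso
      (isFP_cokernel ((dual R C E).map f.op) (hD.isFP_dual hN) (hD.isFP_dual hM))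
    obtain ⟨k, hk⟩ := (hD.bijective hK hM).2 (cokernel.π ((dual R C E).map f.op) ≫ e.inv)
    dsimp only at hk
    have hkf : k ≫ f = 0 := (hD.bijective hK hN).1 (by
      dsimp only
      rw [op_comp, Functor.map_comp, hk, cokernel.condition_assoc, zero_comp, dual_map_zero])
    -- An element is a morphism from a representable. The dual of `k` is epi, and duality is
    -- faithful on finitely presented modules, so a morphism killed by `k` vanishes.
    have hinj : ∀ X, Function.Injective (k.hom.app X) := fun X => by
      refine (injective_iff_map_eq_zero (k.hom.app X).hom).2 fun x hx => ?_
      have h : repHom x ≫ k = 0 := by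
        rw [repHom_comp]
        exact (congrArg repHom hx).trans (repEquiv X M).symm.map_zero
      have h' : (dual R C E).map (repHom x).op = 0 := by
        have := congrArg (fun l => (dual R C E).map (Quiver.Hom.op l)) h
        rw [op_comp, Functor.map_comp, hk, dual_map_zero, Category.assoc] at this
        rw [← cancel_epi e.inv, comp_zero]
        exact zero_of_epi_comp _ this
      have : repHom x = 0 := (hD.bijective (isFP_rep X) hK).1 (h'.trans (dual_map_zero _ _).symm)
      exact (repEquiv X K).symm.injective (this.trans (repEquiv X K).symm.map_zero.symm)
    -- If `f` kills `m`, the dual of `repHom m` factors through the cokernel; fullness of the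
    -- duality turns this into a factorization of `repHom m` through `k`.
    have hex : ∀ X (m : M.obj.obj X), f.hom.app X m = 0 → ∃ x, k.hom.app X x = m := by
      intro X m hm
      have h : repHom m ≫ f = 0 := by
        rw [repHom_comp, hm]
        exact (repEquiv X N).symm.map_zero
      have h' : (dual R C E).map f.op ≫ (dual R C E).map (repHom m).op = 0 := by
        rw [← Functor.map_comp, ← op_comp, h, dual_map_zero]
      obtain ⟨s, hs⟩ := (hD.bijective (isFP_rep X) hK).2
        (e.hom ≫ cokernel.desc _ _ h')
      dsimp only at hs
      have : s ≫ k = repHom m := (hD.bijective (isFP_rep X) hM).1 (by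
        dsimp only
        rw [op_comp, Functor.map_comp, hk, hs]
        simp)
      refine ⟨s.hom.app X (𝟙 X), ?_⟩
      exact (congrArg (fun l : rep X ⟶ M => l.hom.app X (𝟙 X)) this).trans (repHom_app_id m)
    have key : ∀ (X : C) (x : K.obj.obj X),
        (kernel.ι f).hom.app X ((kernel.lift f k hkf).hom.app X x) = k.hom.app X x :=
      fun X x => congrArg (fun l : K ⟶ M => l.hom.app X x) (kernel.lift_ι f k hkf)
    have : IsIso (kernel.lift f k hkf) := isIso_of_bijective _ fun X => by
      refine ⟨fun x y hxy => hinj X ?_, fun z => ?_⟩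
      · rw [← key, hxy, key]
      · obtain ⟨x, hx⟩ := hex X ((kernel.ι f).hom.app X z)
          (congrArg (fun l : kernel f ⟶ N => l.hom.app X z) (kernel.condition f))
        exact ⟨x, injective_of_mono (kernel.ι f) X ((key X x).trans hx)⟩
    exact (IsFP C).prop_of_iso (asIso (kernel.lift f k hkf)) hK

end Duality

/-! ### Modules which are determined at `c` -/

section Local

variable {C : Type u} [Category.{u} C] [Preadditive C]

theorem isIso_homP_map_iff {c : C} {M N : ModC C} (f : M ⟶ N) :
    IsIso ((homP (rep c)).map f) ↔ Function.Bijective (f.hom.app c) := by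
  rw [ConcreteCategory.isIso_iff_bijective]
  have h : (fun x => f.hom.app c x) ∘ repEquiv c M =
      repEquiv c N ∘ (ConcreteCategory.hom ((homP (rep c)).map f)) := rfl
  refine (Function.Bijective.of_comp_iff' (repEquiv c N).bijective _).symm.trans ?_
  rw [← h]
  exact Function.Bijective.of_comp_iff _ (repEquiv c M).bijective

/-- Triangle identity: the unit at `Hom(P, M)` is invertible, hence so is `Hom(P, -)` of the counit.
-/
theorem isIso_homP_map_counit (c : C) (M : ModC C) :
    IsIso ((homP (rep c)).map ((tensorPAdj (rep c)).counit.app M)) := by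
  have h := (tensorPAdj (rep c)).right_triangle_components M
  have : IsIso ((tensorPAdj (rep c)).unit.app ((homP (rep c)).obj M)) := inferInstance
  have h' : IsIso ((tensorPAdj (rep c)).unit.app ((homP (rep c)).obj M) ≫
    (homP (rep c)).map ((tensorPAdj (rep c)).counit.app M)) := by rw [h]; infer_instance
  exact IsIso.of_isIso_comp_left ((tensorPAdj (rep c)).unit.app ((homP (rep c)).obj M)) _

theorem bijective_counit_app (c : C) (M : ModC C) :
    Function.Bijective (((tensorPAdj (rep c)).counit.app M).hom.app c) :=
  (isIso_homP_map_iff _).1 (isIso_homP_map_counit c M)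

/-- The unit `M ⟶ Hom_{R_P}(P^*, Hom(P, M))` is invertible if `M` does not distinguish between
`Hom_C(X, -)` and `P ⊗_{R_P} Hom(P, Hom_C(X, -))`. -/
theorem isIso_homPAdj_unit_app {c : C} {M : ModC C}
    (h : ∀ X : C, Function.Bijective
      (fun f : rep X ⟶ M => (tensorPAdj (rep c)).counit.app (rep X) ≫ f)) :
    IsIso ((homPAdj c).unit.app M) := by
  refine isIso_of_bijective _ fun X => ?_
  -- Precomposition with the counit is, up to the adjunction bijection, the map `f ↦ Hom(P, f)`.
  -- With `C(X, -) ⟶ M` identified with `M(X)`, the latter is the unit at `X`.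
  have e : (fun f : rep X ⟶ M => (tensorPAdj (rep c)).counit.app (rep X) ≫ f) =
      ((tensorPAdj (rep c)).homEquiv ((homP (rep c)).obj (rep X)) M).symm ∘
        (fun f : rep X ⟶ M => (homP (rep c)).map f) := by
    funext f
    exact (((tensorPAdj (rep c)).homEquiv_counit _ _ _).trans
      ((tensorPAdj (rep c)).counit.naturality f)).symm
  have h₁ : Function.Bijective (fun f : rep X ⟶ M => (homP (rep c)).map f) := by
    have := h X
    rw [e] at this
    exact (Function.Bijective.of_comp_iff' (Equiv.bijective _) _).1 this
  have h₂ : (fun x => ((homPAdj c).unit.app M).hom.app X x) =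
      (fun f : rep X ⟶ M => (homP (rep c)).map f) ∘ (repEquiv X M).symm := by
    funext x
    exact Category.comp_id ((homP (rep c)).map (repHom x))
  have h₃ := h₁.comp (repEquiv X M).symm.bijective
  rw [← h₂] at h₃
  exact h₃

end Local

end DualizingVariety

end

noncomputable section

open ZeroObject

namespace DualizingVariety

attribute [local instance] hasBinaryBiproducts_of_finite_biproducts
  hasZeroObject_of_hasFiniteBiproducts

theorem bijective_iso_comp {A : Type u₁} [Category.{v₁} A] {X Y : A} (e : X ≅ Y) (Z : A) :
    Function.Bijective (fun f : Y ⟶ Z => e.hom ≫ f) :=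
  ⟨fun _ _ h => (cancel_epi e.hom).1 h, fun f => ⟨e.inv ≫ f, e.hom_inv_id_assoc f⟩⟩

theorem bijective_comp_iso {A : Type u₁} [Category.{v₁} A] (X : A) {Y Z : A} (e : Y ≅ Z) :
    Function.Bijective (fun f : X ⟶ Y => f ≫ e.hom) :=
  ⟨fun _ _ h => (cancel_mono e.hom).1 h, fun f => ⟨f ≫ e.inv, by simp⟩⟩

/-! ### The opposite of an `R`-linear category -/

section Opposite

variable (R : Type u) [CommRing R] (C : Type u) [Category.{u} C] [Preadditive C]

/-- The opposite of an `R`-linear category is `R`-linear. -/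
@[reducible]
def oppositeLinear [Linear R C] : Linear R Cᵒᵖ where
  homModule X Y := (opEquiv X Y).module R
  smul_comp _ _ _ r f g := Quiver.Hom.unop_inj (Linear.comp_smul _ _ _ g.unop r f.unop)
  comp_smul _ _ _ f r g := Quiver.Hom.unop_inj (Linear.smul_comp _ _ _ r g.unop f.unop)

theorem hasFiniteBiproducts_opposite [HasFiniteBiproducts C] : HasFiniteBiproducts Cᵒᵖ := 
  HasFiniteBiproducts.of_hasFiniteProducts

end Opposite

/-! ### Finite presentation of `Hom_{R_P}(P^*, N)` by duality -/

section Duality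

variable {C : Type u} [Category.{u} C] [Preadditive C]
  {R : Type u} [CommRing R] [Linear R C] {E : ModuleCat.{u} R}

/-- An element of `Hom_R(M(X), E)` as a linear map. -/
abbrev dualHom {M : ModC C} {X : C} (k : ((dual R C E).obj (op M)).obj.obj (op X)) :
    (toModuleR R M).obj X ⟶ E := k

theorem bijective_dual_map_app {M N : ModC C} (f : M ⟶ N) {c : C}
    (hf : Function.Bijective (f.hom.app c)) :
    Function.Bijective (((dual R C E).map f.op).hom.app (op c)) := by
  have : IsIso ((toModuleRMap R f).app c) := (ConcreteCategory.isIso_iff_bijective _).2 hf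
  constructor
  · intro k k' h
    exact (cancel_epi ((toModuleRMap R f).app c)).1 h
  · intro k
    exact ⟨inv ((toModuleRMap R f).app c) ≫ dualHom k,
      IsIso.hom_inv_id_assoc ((toModuleRMap R f).app c) (dualHom k)⟩

/-- A morphism to the dual of `C(c, -)` is determined by the functional on `A(c)` which evaluates at
`1_c`. -/
theorem dual_rep_app {c : C} {A : ModC Cᵒᵖ} (α : A ⟶ (dual R C E).obj (op (rep c))) {X : C}
    (a : A.obj.obj (op X)) (g : c ⟶ X) :
    (dualHom (α.hom.app (op X) a)).hom g =
      (dualHom (α.hom.app (op c) (A.obj.map g.op a))).hom (𝟙 c) := by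
  rw [naturality_apply]
  exact congrArg (dualHom (α.hom.app (op X) a)).hom (Category.id_comp g).symm

/-- The module `Hom_R(Hom_C(c, -), E)` does not distinguish between modules which agree at `c`. -/
theorem bijective_comp_dual_rep {c : C} {T A : ModC Cᵒᵖ} (u : T ⟶ A)
    (hu : Function.Bijective (u.hom.app (op c))) :
    Function.Bijective (fun α : A ⟶ (dual R C E).obj (op (rep c)) => u ≫ α) := by
  constructor
  · intro α α' h
    refine mod_hom_ext fun X a => ModuleCat.hom_ext <| LinearMap.ext fun g : c ⟶ X.unop => ?_
    obtain ⟨t, ht⟩ := hu.2 (A.obj.map g.op a)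
    refine (dual_rep_app α a g).trans (Eq.trans ?_ (dual_rep_app α' a g).symm)
    rw [← ht]
    exact congrArg (fun k : T ⟶ (dual R C E).obj (op (rep c)) =>
      (dualHom (k.hom.app (op c) t)).hom (𝟙 c)) h
  · intro τ
    let w : A.obj.obj (op c) ≃+ T.obj.obj (op c) :=
      (AddEquiv.ofBijective (u.hom.app (op c)).hom hu).symm
    have hw : ∀ t, w (u.hom.app (op c) t) = t := fun t =>
      (AddEquiv.ofBijective (u.hom.app (op c)).hom hu).symm_apply_apply t
    have hw' : ∀ (g : c ⟶ c) (a : A.obj.obj (op c)),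
        w (A.obj.map g.op a) = T.obj.map g.op (w a) := fun g a => by
      obtain ⟨t, rfl⟩ := hu.2 a
      rw [← naturality_apply, hw, hw]
    -- The functional on `T(c)` that determines `τ`, carried to `A(c)` by the inverse of `u` at `c`.
    let φ : A.obj.obj (op c) →+ E :=
      AddMonoidHom.mk' (fun a => (dualHom (τ.hom.app (op c) (w a))).hom (𝟙 c)) fun a a' => by
        rw [map_add, map_add]
        rfl
    have hφ : ∀ (r : R) (a : A.obj.obj (op c)), φ (A.obj.map (r • 𝟙 c).op a) = r • φ a := by
      intro r a
      change (dualHom (τ.hom.app (op c) (w (A.obj.map (r • 𝟙 c).op a)))).hom (𝟙 c) = _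
      rw [hw', naturality_apply]
      exact map_smul (dualHom (τ.hom.app (op c) (w a))).hom r
        (show (toModuleR R (rep c)).obj c from 𝟙 c)
    -- The extension of `τ` is forced by `dual_rep_app`: `a` must go to `g ↦ φ(a·g)`.
    let ψ : ∀ (X : C) (a : A.obj.obj (op X)), (toModuleR R (rep c)).obj X ⟶ E := fun X a =>
      letI := evalModule R (rep c) X
      ModuleCat.ofHom
        { toFun := fun g : c ⟶ X => φ (A.obj.map g.op a)
          map_add' := fun g g' : c ⟶ X =>
            (congrArg φ (map_add_apply A g.op g'.op a)).trans (map_add φ _ _)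
          map_smul' := fun r (g : c ⟶ X) => by
            have : g ≫ (r • 𝟙 X) = (r • 𝟙 c) ≫ g := by simp
            change φ (A.obj.map (g ≫ (r • 𝟙 X)).op a) = r • φ _
            rw [this, op_comp, map_comp_apply, hφ] }
    refine ⟨modHomMk (fun X => AddMonoidHom.mk' (fun a => ψ X.unop a) fun a a' =>
      ModuleCat.hom_ext <| LinearMap.ext fun g : c ⟶ X.unop => ?_) fun {X Y} f a =>
        ModuleCat.hom_ext <| LinearMap.ext fun g : c ⟶ Y.unop => ?_, ?_⟩
    · change φ (A.obj.map g.op (a + a')) = φ (A.obj.map g.op a) + φ (A.obj.map g.op a')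
      rw [map_add, map_add]
    · change φ (A.obj.map g.op (A.obj.map f a)) = φ (A.obj.map (g ≫ f.unop).op a)
      rw [op_comp, map_comp_apply, Quiver.Hom.op_unop]
    · refine mod_hom_ext fun X t => ModuleCat.hom_ext <| LinearMap.ext fun g : c ⟶ X.unop => ?_
      change (dualHom (τ.hom.app (op c) (w (A.obj.map g.op (u.hom.app X t))))).hom (𝟙 c) = _
      rw [← naturality_apply, hw]
      exact (dual_rep_app τ t g).symm

variable [HasFiniteBiproducts C] [IsNoetherianRing R]

/-- If `N` is a finitely generated `R_P`-module, then `Hom_{R_P}(P^*, N)` is finitely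
presented. -/
theorem IsDuality.isFP_homPStar (hD : IsDuality C R E)
    (hR : ∀ X Y : C, Module.Finite R (X ⟶ Y)) (c : C) {N : ModuleCat.{u} (RP (rep c))}
    (hN : ModuleCat.isFG (RP (rep c)) N) : IsFP C ((homPStar (rep c)).obj N) := by
  have := hasFiniteBiproducts_opposite C
  let : Linear R Cᵒᵖ := oppositeLinear R C
  have hR' : ∀ X Y : Cᵒᵖ, Module.Finite R (X ⟶ Y) := fun X Y =>
    (hR Y.unop X.unop).equiv ((opEquiv X Y).linearEquiv R).symm
  have := isNoetherianRing_rp R c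
  have := isNoetherianRing_rp R (op c)
  let j' := tensorPAdj (rep (op c))
  let M := (tensorP (rep c)).obj N
  have hM : IsFP C M := isFP_tensorP c hN
  let A := (dual R C E).obj (op M)
  have hA : IsFP Cᵒᵖ A := hD.isFP_dual hM
  let N' := (homP (rep (op c))).obj A
  let T := (tensorP (rep (op c))).obj N'
  have hT : IsFP Cᵒᵖ T := isFP_tensorP (op c) (isFG_homP R (op c) (fun X => hR' X _) hA)
  let u : T ⟶ A := j'.counit.app A
  obtain ⟨M', hM', ⟨e⟩⟩ := hD.exists_iso hT
  -- Up to the isomorphism `e`, the counit `u` is the dual of a morphism `v : M ⟶ M'`.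
  obtain ⟨v, hv⟩ := (hD.bijective hM hM').2 (e.hom ≫ u)
  dsimp only at hv
  have hP : IsFP C (rep c) := isFP_rep c
  -- Dualizing turns composition with `v` on `Hom(P, M)` into composition with `u` on morphisms to
  -- the dual of `P`. That is bijective because `u` is bijective at `c`.
  have hv' : IsIso ((homP (rep c)).map v) := by
    refine (ConcreteCategory.isIso_iff_bijective _).2 ?_
    have h₁ : (fun f : rep c ⟶ M' => (dual R C E).map f.op) ∘ (fun f : rep c ⟶ M => f ≫ v) =
        ((fun α => e.hom ≫ α) ∘ (fun α => u ≫ α)) ∘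
          (fun f : rep c ⟶ M => (dual R C E).map f.op) := by
      funext f
      simp [hv]
    have h₃ := ((bijective_iso_comp e _).comp (bijective_comp_dual_rep (R := R) (E := E) u
      (bijective_counit_app (op c) A))).comp (hD.bijective hP hM)
    rw [← h₁] at h₃
    exact (Function.Bijective.of_comp_iff' (hD.bijective hP hM') _).1 h₃
  -- Dualizing turns precomposition with the counit `ε` into postcomposition with `δ` on morphisms
  -- out of `T`. Those are morphisms from `N'` into `Hom(C(-, c), -)`, and the latter inverts `δ`
  -- because `ε` is bijective at `c`.
  have hlocal : ∀ X : C, Function.Bijective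
      (fun f : rep X ⟶ M' => (tensorPAdj (rep c)).counit.app (rep X) ≫ f) := by
    intro X
    let Y := (tensorP (rep c)).obj ((homP (rep c)).obj (rep X))
    have hX : IsFP C (rep X) := isFP_rep X
    have hY : IsFP C Y := isFP_tensorP c (isFG_homP R c (fun X => hR X c) hX)
    let ε : Y ⟶ rep X := (tensorPAdj (rep c)).counit.app (rep X)
    let δ := (dual R C E).map ε.op
    have hδ : IsIso ((homP (rep (op c))).map δ) :=
      (isIso_homP_map_iff δ).2 (bijective_dual_map_app ε (bijective_counit_app c (rep X)))
    have h₁ : (j'.homEquiv N' _) ∘ (fun α : T ⟶ (dual R C E).obj (op (rep X)) => α ≫ δ) =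
        (fun β => β ≫ (homP (rep (op c))).map δ) ∘ (j'.homEquiv N' _) := by
      funext α
      exact j'.homEquiv_naturality_right α δ
    have h₂ : Function.Bijective (fun α : T ⟶ (dual R C E).obj (op (rep X)) => α ≫ δ) := by
      refine (Function.Bijective.of_comp_iff' (j'.homEquiv N' _).bijective _).1 ?_
      rw [h₁]
      exact (bijective_comp_iso N' (@asIso _ _ _ _ _ hδ)).comp (Equiv.bijective _)
    have h₃ : Function.Bijective
        (fun α : (dual R C E).obj (op M') ⟶ (dual R C E).obj (op (rep X)) => α ≫ δ) := by
      have h := (bijective_iso_comp e _).comp (h₂.comp (bijective_iso_comp e.symm _))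
      convert h using 1
      funext α
      simp
    have h₄ : (fun f : Y ⟶ M' => (dual R C E).map f.op) ∘ (fun f : rep X ⟶ M' => ε ≫ f) =
        (fun α => α ≫ δ) ∘ (fun f : rep X ⟶ M' => (dual R C E).map f.op) := by
      funext f
      simp [δ]
    have h₅ := h₃.comp (hD.bijective hX hM')
    rw [← h₄] at h₅
    exact (Function.Bijective.of_comp_iff' (hD.bijective hY hM') _).1 h₅
  have := isIso_homPAdj_unit_app hlocal
  have := isIso_tensorPAdj_unit_app c N
  -- `M' ≅ Hom_{R_P}(P^*, Hom(P, M'))`, and `Hom(P, M') ≅ Hom(P, M) ≅ N` by `v` and the unit at `N`.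
  exact (IsFP C).prop_of_iso (asIso ((homPAdj c).unit.app M') ≪≫
    (homPStar (rep c)).mapIso (asIso ((tensorPAdj (rep c)).unit.app N) ≪≫
      asIso ((homP (rep c)).map v)).symm) hM'

end Duality

end DualizingVariety

end

noncomputable section

open ZeroObject

namespace DualizingVariety

attribute [local instance] hasBinaryBiproducts_of_finite_biproducts
  hasZeroObject_of_hasFiniteBiproducts

/-! ### The functor `C(C/I, -)` -/

section QuotHom

variable {C : Type u} [Category.{u} C] [Preadditive C]

/-- The unit sends `m` to `Hom(P, repHom m)`, which under Yoneda is `g ↦ g·m` on `C(Z, c)`. -/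
theorem homPAdj_unit_app_eq_zero_iff {c : C} {M : ModC C} {Z : C} (m : M.obj.obj Z) :
    ((homPAdj c).unit.app M).hom.app Z m = 0 ↔ ∀ g : Z ⟶ c, M.obj.map g m = 0 := by
  have h : homPStarHom (((homPAdj c).unit.app M).hom.app Z m) = (homP (rep c)).map (repHom m) :=
    Category.comp_id ((homP (rep c)).map (repHom m))
  constructor
  · intro hm g
    have h' := congrArg (fun k : (homP (rep c)).obj (rep Z) ⟶ (homP (rep c)).obj M =>
      (show rep c ⟶ M from k.hom (repHom (M := rep Z) g)).hom.app c (𝟙 c)) (h.symm.trans hm)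
    exact (congrArg (fun g => M.obj.map g m) (Category.comp_id g).symm).trans h'
  · intro hm
    refine h.trans (ModuleCat.hom_ext <| LinearMap.ext fun k : rep c ⟶ rep Z => ?_)
    exact rep_hom_ext (M := M) (hm (show Z ⟶ c from k.hom.app c (𝟙 c)))

/-- An element of `M(Z)` annihilated by the ideal defines a morphism from
`Hom_C(Z, -) / I(Z, -)` to `M`. -/
theorem exists_quotHom {I : CatIdeal C} {M : ModC C} {Z : C} (m : M.obj.obj Z)
    (hm : ∀ (Y : C) (f : Z ⟶ Y), f ∈ I.carrier Z Y → M.obj.map f m = 0) :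
    ∃ k : I.piStar.obj (rep (I.proj.obj Z)) ⟶ M, k.hom.app Z (𝟙 (I.proj.obj Z)) = m := by
  -- Arbitrary lifts along `π`; since the ideal kills `m`, the element obtained from `m` does not
  -- depend on the lift.
  choose s hs using fun (Y : C) (q : I.proj.obj Z ⟶ I.proj.obj Y) => I.proj.map_surjective q
  have key : ∀ {Y : C} (g : Z ⟶ Y), M.obj.map (s Y (I.proj.map g)) m = M.obj.map g m := by
    intro Y g
    rw [← sub_eq_zero, ← map_sub_apply]
    exact hm Y _ ((CategoryTheory.Quotient.functor_map_eq_iff I.homRel _ _).1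
      (hs Y (I.proj.map g)))
  refine ⟨modHomMk (fun Y => AddMonoidHom.mk'
    (fun q : I.proj.obj Z ⟶ I.proj.obj Y => M.obj.map (s Y q) m) fun q q' => ?_)
    fun {Y Y'} f q => ?_, ?_⟩
  · obtain ⟨g, rfl⟩ := I.proj.map_surjective (show I.proj.obj Z ⟶ I.proj.obj Y from q)
    obtain ⟨g', rfl⟩ := I.proj.map_surjective (show I.proj.obj Z ⟶ I.proj.obj Y from q')
    refine (key (g + g')).trans ((map_add_apply M g g' m).trans ?_)
    rw [← key g, ← key g']
  · obtain ⟨g, rfl⟩ := I.proj.map_surjective (show I.proj.obj Z ⟶ I.proj.obj Y from q)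
    have : I.proj.map g ≫ I.proj.map f = I.proj.map (g ≫ f) := (I.proj.map_comp g f).symm
    change M.obj.map (s Y' (I.proj.map g ≫ I.proj.map f)) m =
      M.obj.map f (M.obj.map (s Y (I.proj.map g)) m)
    rw [this, key, key, map_comp_apply]
  · have : 𝟙 (I.proj.obj Z) = I.proj.map (𝟙 Z) := (I.proj.map_id Z).symm
    change M.obj.map (s Z (𝟙 (I.proj.obj Z))) m = m
    rw [this, key, map_id_apply]

theorem piStar_rep_hom_app {I : CatIdeal C} {M : ModC C} {Z : C}
    (k : I.piStar.obj (rep (I.proj.obj Z)) ⟶ M) {Y : C} (g : Z ⟶ Y) :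
    k.hom.app Y (I.proj.map g) = M.obj.map g (k.hom.app Z (𝟙 (I.proj.obj Z))) :=
  (congrArg (k.hom.app Y) (Category.id_comp (I.proj.map g)).symm).trans
    (naturality_apply k g
      (show (I.piStar.obj (rep (I.proj.obj Z))).obj.obj Z from 𝟙 (I.proj.obj Z)))

variable [HasFiniteBiproducts C]

theorem proj_map_eq_zero {c Z : C} (g : Z ⟶ c) : (factorIdeal c).proj.map g = 0 := by
  rw [← (factorIdeal c).proj.map_zero, CategoryTheory.Quotient.functor_map_eq_iff]
  change g - 0 ∈ _
  rw [sub_zero, mem_factorIdeal_iff]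
  exact ⟨1, biproduct.lift fun _ => g, biproduct.desc fun _ => 𝟙 c, by simp [biproduct.lift_desc]⟩

/-- `π_* C(C/I, M)` is the kernel of the unit `M ⟶ Hom_{R_P}(P^*, Hom(P, M))`. -/
theorem isFP_quotHom [(IsFP C).IsClosedUnderKernels] {c : C} {M : ModC C} (hM : IsFP C M)
    (hM' : IsFP C ((homPStar (rep c)).obj ((homP (rep c)).obj M))) :
    IsFP (factorIdeal c).Quot ((factorIdeal c).quotHom.obj M) := by
  let I := factorIdeal c
  let η := (homPAdj c).unit.app M
  let κ : I.piStar.obj (I.quotHom.obj M) ⟶ M := (quotHomAdj I).counit.app M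
  -- The counit evaluates `k` at the identity, so `g` sends its value to `k(πg)`, and `πg = 0` for
  -- every `g` with target `c`.
  have w : κ ≫ η = 0 := mod_hom_ext fun Z k => by
    refine (homPAdj_unit_app_eq_zero_iff (c := c) (κ.hom.app Z k)).2 fun g => ?_
    refine (piStar_rep_hom_app (quotHomHom (I := I) k) g).symm.trans ?_
    exact (congrArg ((quotHomHom (I := I) k).hom.app c) (proj_map_eq_zero g)).trans
      (map_zero ((quotHomHom (I := I) k).hom.app c).hom)
  have key : ∀ (Z : C) (k : (I.piStar.obj (I.quotHom.obj M)).obj.obj Z),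
      (kernel.ι η).hom.app Z ((kernel.lift η κ w).hom.app Z k) = κ.hom.app Z k :=
    fun Z k => congrArg (fun l : I.piStar.obj (I.quotHom.obj M) ⟶ M => l.hom.app Z k)
      (kernel.lift_ι η κ w)
  -- Injective since `k` is determined by its value at the identity. Surjective since an element
  -- killed by all morphisms to `c` is killed by the whole ideal and so is the value of some `k`.
  have : IsIso (kernel.lift η κ w) := isIso_of_bijective _ fun Z => by
    refine ⟨fun k k' h => ?_, fun z => ?_⟩
    · have h' : κ.hom.app Z k = κ.hom.app Z k' := by rw [← key, h, key]
      refine mod_hom_ext (M := I.piStar.obj (rep (I.proj.obj Z))) fun Y q => ?_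
      obtain ⟨g, rfl⟩ := I.proj.map_surjective (show I.proj.obj Z ⟶ I.proj.obj Y from q)
      exact (piStar_rep_hom_app (quotHomHom k) g).trans ((congrArg (M.obj.map g) h').trans
        (piStar_rep_hom_app (quotHomHom k') g).symm)
    · have hz : η.hom.app Z ((kernel.ι η).hom.app Z z) = 0 :=
        congrArg (fun l : kernel η ⟶ _ => l.hom.app Z z) (kernel.condition η)
      have hz' := (homPAdj_unit_app_eq_zero_iff _).1 hz
      obtain ⟨k, hk⟩ := exists_quotHom (I := I) ((kernel.ι η).hom.app Z z)
        fun Y f hf => map_eq_zero_of_mem_factorIdeal hz' hf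
      exact ⟨k, injective_of_mono (kernel.ι η) Z ((key Z k).trans hk)⟩
  exact isFP_of_isFP_piStar I ((IsFP C).prop_of_iso (asIso (kernel.lift η κ w)).symm
    ((IsFP C).prop_kernel η hM hM'))

end QuotHom

/-! ### The recollement -/

section Recollement

theorem isAbelianCat_of_abelian (A : Type u₁) [Category.{v₁} A] [Abelian A] : IsAbelianCat A where
  hasFiniteProducts := inferInstance
  hasKernels := inferInstance
  hasCokernels := inferInstance
  isNormalMono := inferInstance
  isNormalEpi := inferInstance

/-- The restriction of an adjunction to full subcategories which are preserved by the functors. -/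
def restrictAdj {A : Type u₁} [Category.{v₁} A] {B : Type u₂} [Category.{v₂} B]
    {S : ObjectProperty A} {T : ObjectProperty B} {F : A ⥤ B} {G : B ⥤ A} (adj : F ⊣ G)
    (hF : ∀ X : A, S X → T (F.obj X)) (hG : ∀ X : B, T X → S (G.obj X)) :
    restrict S T F hF ⊣ restrict T S G hG :=
  adj.restrictFullyFaithful S.fullyFaithfulι T.fullyFaithfulι (Iso.refl _) (Iso.refl _)

variable {C : Type u} [Category.{u} C] [Preadditive C]

/-- The identity of `c` lies in the ideal, so `c` becomes a zero object in the quotient and `F`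
vanishes there. -/
theorem isZero_homP_piStar [HasFiniteBiproducts C] (c : C) (F : ModC (factorIdeal c).Quot) :
    IsZero ((homP (rep c)).obj ((factorIdeal c).piStar.obj F)) := by
  have h : ∀ x : F.obj.obj ((factorIdeal c).proj.obj c), x = 0 := fun x => by
    have e : 𝟙 ((factorIdeal c).proj.obj c) = 0 :=
      ((factorIdeal c).proj.map_id c).symm.trans (proj_map_eq_zero (𝟙 c))
    rw [← map_id_apply F x, e, map_zero_apply]
  have : Subsingleton ((homP (rep c)).obj ((factorIdeal c).piStar.obj F)) :=
    ⟨fun a b => rep_hom_ext (M := (factorIdeal c).piStar.obj F) ((h _).trans (h _).symm)⟩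
  exact ModuleCat.isZero_of_subsingleton _

theorem tensorP_rep_fullyFaithful (c : C) : (tensorP (rep c)).Full ∧ (tensorP (rep c)).Faithful :=
  let h := (tensorPAdj (rep c)).fullyFaithfulLOfIsIsoUnit
  ⟨h.full, h.faithful⟩

/-- In an adjoint triple one outer functor is fully faithful exactly when the other is. -/
theorem homPStar_rep_fullyFaithful (c : C) :
    (homPStar (rep c)).Full ∧ (homPStar (rep c)).Faithful :=
  let h := (Adjunction.Triple.mk (tensorPAdj (rep c)) (homPAdj c)).fullyFaithfulEquiv
    (tensorPAdj (rep c)).fullyFaithfulLOfIsIsoUnit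
  ⟨h.full, h.faithful⟩

end Recollement

end DualizingVariety

end

open DualizingVariety
theorem mainTheorem2 (R : Type u) [CommRing R] [IsArtinianRing R]
    (C : Type u) [SmallCategory C] [Preadditive C] [Linear R C]
    [HasFiniteBiproducts C] [IsIdempotentComplete C]
    (hC : IsDualizing R C) (c : C) :
    (∃ (h₁ : ∀ M, IsFP C M → IsFP (factorIdeal c).Quot ((factorIdeal c).quotTensor.obj M))
      (h₂ : ∀ F, IsFP (factorIdeal c).Quot F → IsFP C ((factorIdeal c).piStar.obj F))
      (h₃ : ∀ M, IsFP C M → IsFP (factorIdeal c).Quot ((factorIdeal c).quotHom.obj M))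
      (h₄ : ∀ N, ModuleCat.isFG (RP (rep c)) N → IsFP C ((tensorP (rep c)).obj N))
      (h₅ : ∀ M, IsFP C M → ModuleCat.isFG (RP (rep c)) ((homP (rep c)).obj M))
      (h₆ : ∀ N, ModuleCat.isFG (RP (rep c)) N → IsFP C ((homPStar (rep c)).obj N)),
      IsRecollement
        (restrict (IsFP C) (IsFP (factorIdeal c).Quot) (factorIdeal c).quotTensor h₁)
        (restrict (IsFP (factorIdeal c).Quot) (IsFP C) (factorIdeal c).piStar h₂)
        (restrict (IsFP C) (IsFP (factorIdeal c).Quot) (factorIdeal c).quotHom h₃)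
        (restrict (ModuleCat.isFG (RP (rep c))) (IsFP C) (tensorP (rep c)) h₄)
        (restrict (IsFP C) (ModuleCat.isFG (RP (rep c))) (homP (rep c)) h₅)
        (restrict (ModuleCat.isFG (RP (rep c))) (IsFP C) (homPStar (rep c)) h₆)) ∧
    factorIdeal c = traceIdeal (rep c) := by
  refine ⟨?_, factorIdeal_eq_traceIdeal c⟩
  have : HasZeroObject C := hasZeroObject_of_hasFiniteBiproducts C
  have : HasBinaryBiproducts C := hasBinaryBiproducts_of_finite_biproducts C
  have : HasZeroObject (factorIdeal c).Quot := hasZeroObject_of_hasFiniteBiproducts _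
  have : HasBinaryBiproducts (factorIdeal c).Quot := hasBinaryBiproducts_of_finite_biproducts _
  have : HasFiniteBiproducts Cᵒᵖ := hasFiniteBiproducts_opposite C
  have hR := hC.homFinite
  obtain ⟨E, hD⟩ := hC.exists_isDuality
  have : (IsFP C).IsClosedUnderKernels := hD.isClosedUnderKernels
  have : IsNoetherianRing (RP (rep c)) := isNoetherianRing_rp R c
  have h₂ : ∀ F, IsFP (factorIdeal c).Quot F → IsFP C ((factorIdeal c).piStar.obj F) :=
    fun F => isFP_piStar (fun X => exists_approximation R c X)
  have : (IsFP (factorIdeal c).Quot).IsClosedUnderKernels := isClosedUnderKernels_quot _ h₂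
  have h₅ : ∀ M, IsFP C M → ModuleCat.isFG (RP (rep c)) ((homP (rep c)).obj M) :=
    fun M => isFG_homP R c fun X => hR X c
  have h₆ : ∀ N, ModuleCat.isFG (RP (rep c)) N → IsFP C ((homPStar (rep c)).obj N) :=
    fun N => hD.isFP_homPStar hR c
  have : (homPStar (rep c)).Additive := (homPAdj c).right_adjoint_additive
  obtain ⟨_, _⟩ := tensorP_rep_fullyFaithful c
  obtain ⟨_, _⟩ := homPStar_rep_fullyFaithful c
  -- The case of `C(C/I, M)` rests on `h₅` and `h₆`: the target of the unit at `M` must be finitely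
  -- presented for its kernel to be.
  refine ⟨fun M => isFP_quotTensor _, h₂, fun M hM => isFP_quotHom hM (h₆ _ (h₅ _ hM)),
    fun N => isFP_tensorP c, h₅, h₆, ?_⟩
  exact
    { abelian_left := isAbelianCat_of_abelian _
      abelian_middle := isAbelianCat_of_abelian _
      abelian_right := isAbelianCat_of_abelian (FGModuleCat (RP (rep c)))
      additive_iUpperStar := inferInstance
      additive_iStar := inferInstance
      additive_iShriek := inferInstance
      additive_jShriek := inferInstance
      additive_jUpperStar := inferInstance
      additive_jStar := inferInstance
      adj_i := ⟨restrictAdj (quotTensorAdj _) _ _⟩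
      adj_i' := ⟨restrictAdj (quotHomAdj _) _ _⟩
      adj_j := ⟨restrictAdj (tensorPAdj _) _ _⟩
      adj_j' := ⟨restrictAdj (homPAdj c) _ _⟩
      comp_zero := fun F => IsZero.of_full_of_faithful_of_isZero
        (ModuleCat.isFG (RP (rep c))).ι _ (isZero_homP_piStar c F.obj)
      full_iStar := inferInstance
      faithful_iStar := inferInstance
      full_jShriek := inferInstance
      faithful_jShriek := inferInstance
      full_jStar := inferInstance
      faithful_jStar := inferInstance }
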